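/- All objects are $C^\infty$. Let $M$ be a 3-dimensional manifold and let $\Sigma=(f,g)$ be a control-affine system $\dot\xi=f(\xi)+g(\xi)u$, $u\in\mathbb R$, on $M$ such that, at every point, $f\wedge g\wedge[g,f]\neq0$ and $g\wedge[g,f]\wedge[g,[g,f]]\neq0$. The structure functions of such a pair are the functions $k_i,\lambda_i$ uniquely defined by $$[f,[f,g]]=k_1g+k_2[g,f]+k_3[g,[g,f]],\qquad [g,[g,f]]=\lambda_1f+\lambda_2g+\lambda_3[g,f],$$ where $L_{[f,g]}=L_fL_g-L_gL_f$. The pair is called canonical if $k_3=0$ and $\lambda_1=\pm1$. The canonical pair of $\Sigma$ is $f_c=f+k_3g$, $g_c=|\lambda_1|^{-1/2}g$ (unique up to $g_c\mapsto-g_c$), and the invariants $(\varepsilon,\kappa,\nu)$ of $\Sigma$ are the structure functions $(\lambda_1,k_1,\lambda_3)$ of its canonical pair. A local feedback equivalence of $\Sigma$ with $(\tilde f,\tilde g)$ is a diffeomorphism $\phi$ from an open subset of $M$ onto an open subset of $\mathbb R^3$, with functions $\alpha$ and $\beta\neq0$ on its domain, such that $\tilde f=\phi_*(f+\alpha g)$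 and $\tilde g=\phi_*(\beta g)$. For functions of one variable put $W(F,G)=F'G-FG'$, and let $W'(F,G)$ be the derivative of $W(F,G)$. Suppose that $\kappa=0$, $L_{f_c}\nu=0$ and $L_{[f_c,g_c]}\nu=0$ on $M$, and let $\xi_0\in M$. Then: (i) Around $\xi_0$, $\Sigma$ is locally feedback equivalent to a system of the form $$(T):\quad \dot x=F_1(w),\quad \dot y=F_2(w),\quad \dot w=u .$$ Whenever $\Sigma$ is locally feedback equivalent to such a system $(T)$, then, on the image of the equivalence, $(T)$ satisfies the two regularity assumptions above, $W(F_1,F_2)\ne0$, and the structure functions of $(T)$ are $k_1=k_2=k_3=0$, $\lambda_1=-\dfrac{W(F_1',F_2')}{W(F_1,F_2)}$, $\lambda_2=0$, $\lambda_3=\dfrac{W'(F_1,F_2)}{W(F_1,F_2)}$. (ii) Around $\xi_0$, $\Sigma$ is locally feedback equivalent to each of two systems $$\Sigma_c^{T,1}:\ \dot x=F_{c,1}(w),\ \dot y=F_{c,2}(w),\ \dot w=u,\qquad \Sigma_c^{T,2}:\ \dot x=1+\varepsilon yu,\ \dot y=(x-\nu(w)y)u,\ \dot w=u,$$ where $\frac{W(F_{c,1}',F_{c,2}')}{W(F_{c,1},F_{c,2})}$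 is constant equal to $1$ or to $-1$, $\varepsilon$ is a constant equal to $1$ or $-1$, and $\nu$ is a function of $w$ only. Both systems are given by canonical pairs (on the image of the equivalence), the diffeomorphisms carry the canonical pair $(f_c,g_c)$ of $\Sigma$ to these pairs, and their invariants are $$(\varepsilon^1,\kappa^1,\nu^1)=\left(-\frac{W(F_{c,1}',F_{c,2}')}{W(F_{c,1},F_{c,2})},\,0,\,\frac{W'(F_{c,1},F_{c,2})}{W(F_{c,1},F_{c,2})}\right),\qquad(\varepsilon^2,\kappa^2,\nu^2)=(\varepsilon,0,\nu(w)),$$ respectively; pulled back by the respective diffeomorphisms, they are the invariants of $\Sigma$. -/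

import Mathlib

open scoped Manifold ContDiff

namespace TrivialControl

noncomputable section

/-- The coefficients `c` of `v = ∑ i, c i • b i`; meaningful when `b` is a basis
(see `sum_coords` and `coords_unique`). -/
def coords {V : Type*} [AddCommGroup V] [Module ℝ V] (b : Fin 3 → V) (v : V) : Fin 3 → ℝ :=
  Classical.epsilon fun c => ∑ i, c i • b i = v

theorem sum_coords {V : Type*} [AddCommGroup V] [Module ℝ V]
    (hV : Module.finrank ℝ V = 3) {b : Fin 3 → V} (hb : LinearIndependent ℝ b) (v : V) :
    ∑ i, coords b v i • b i = v := by
  have : FiniteDimensional ℝ V := Module.finite_of_finrank_pos (by omega)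
  have hspan : Submodule.span ℝ (Set.range b) = ⊤ :=
    hb.span_eq_top_of_card_eq_finrank' (by simp [hV])
  have hv : v ∈ Submodule.span ℝ (Set.range b) := by rw [hspan]; trivial
  have hex : ∃ c : Fin 3 → ℝ, ∑ i, c i • b i = v :=
    (Submodule.mem_span_range_iff_exists_fun ℝ).1 hv
  exact Classical.epsilon_spec hex

theorem coords_unique {V : Type*} [AddCommGroup V] [Module ℝ V]
    {b : Fin 3 → V} (hb : LinearIndependent ℝ b) (c : Fin 3 → ℝ) :
    coords b (∑ i, c i • b i) = c := by
  have h : ∑ i, coords b (∑ i, c i • b i) i • b i = ∑ i, c i • b i :=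
    Classical.epsilon_spec (p := fun d : Fin 3 → ℝ => ∑ i, d i • b i = ∑ i, c i • b i) ⟨c, rfl⟩
  have h' : ∑ i, (coords b (∑ i, c i • b i) i - c i) • b i = 0 := by
    simp only [sub_smul, Finset.sum_sub_distrib, h, sub_self]
  funext i
  exact sub_eq_zero.1 (Fintype.linearIndependent_iff.1 hb _ h' i)

/-- The model space `ℝ³`. -/
abbrev E3 : Type := EuclideanSpace ℝ (Fin 3)

/-- Vector fields on a manifold modelled on `ℝ³`. -/
abbrev VF (M : Type*) [TopologicalSpace M] [ChartedSpace E3 M] : Type _ :=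
  (ξ : M) → TangentSpace (𝓡 3) ξ

section Systems

variable {M : Type*} [TopologicalSpace M] [ChartedSpace E3 M]

/-- Smooth vector fields, i.e. smooth sections of the tangent bundle. -/
def SmoothVF [IsManifold (𝓡 3) ∞ M] (f : VF M) : Prop :=
  ContMDiff (𝓡 3) (𝓡 3).tangent ∞ (fun ξ => (⟨ξ, f ξ⟩ : TangentBundle (𝓡 3) M))

/-- The Lie bracket `[f, g]`, normalised by `L_[f,g] = L_f L_g - L_g L_f`. -/
def br (f g : VF M) : VF M := VectorField.mlieBracket (𝓡 3) f g

/-- The Lie derivative `L_f h` of a function `h`. -/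
def lieD (f : VF M) (h : M → ℝ) (ξ : M) : ℝ := mfderiv (𝓡 3) 𝓘(ℝ, ℝ) h ξ (f ξ)

/-- The frame `f, g, [g,f]`. -/
def frameA (f g : VF M) (ξ : M) : Fin 3 → TangentSpace (𝓡 3) ξ :=
  ![f ξ, g ξ, br g f ξ]

/-- The frame `g, [g,f], [g,[g,f]]`. -/
def frameB (f g : VF M) (ξ : M) : Fin 3 → TangentSpace (𝓡 3) ξ :=
  ![g ξ, br g f ξ, br g (br g f) ξ]

/-- The regularity assumptions `f ∧ g ∧ [g,f] ≠ 0` and `g ∧ [g,f] ∧ [g,[g,f]] ≠ 0` on `U`. -/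
def RegularOn (f g : VF M) (U : Set M) : Prop :=
  ∀ ξ ∈ U, LinearIndependent ℝ (frameA f g ξ) ∧ LinearIndependent ℝ (frameB f g ξ)

/-- The structure functions `k₁, k₂, k₃` (indices `0, 1, 2`):
`[f,[f,g]] = k₁ g + k₂ [g,f] + k₃ [g,[g,f]]`. -/
def kFun (f g : VF M) (i : Fin 3) (ξ : M) : ℝ :=
  coords (frameB f g ξ) (br f (br f g) ξ) i

/-- The structure functions `λ₁, λ₂, λ₃` (indices `0, 1, 2`):
`[g,[g,f]] = λ₁ f + λ₂ g + λ₃ [g,f]`. -/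
def lamFun (f g : VF M) (i : Fin 3) (ξ : M) : ℝ :=
  coords (frameA f g ξ) (br g (br g f) ξ) i

/-- The pair `(f, g)` is canonical on `U`: `k₃ = 0` and `λ₁ = ±1`. -/
def IsCanonicalOn (f g : VF M) (U : Set M) : Prop :=
  RegularOn f g U ∧ ∀ ξ ∈ U, kFun f g 2 ξ = 0 ∧ (lamFun f g 0 ξ = 1 ∨ lamFun f g 0 ξ = -1)

/-- The drift `f_c = f + k₃ g` of the canonical pair of `(f, g)`. -/
def canF (f g : VF M) : VF M := fun ξ => f ξ + kFun f g 2 ξ • g ξ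

/-- The control vector field `g_c = |λ₁|^(-1/2) g` of the canonical pair of `(f, g)`. -/
def canG (f g : VF M) : VF M := fun ξ => (|lamFun f g 0 ξ| ^ (-(1 / 2) : ℝ)) • g ξ

/-- The discrete invariant `ε` of `(f, g)`, i.e. `λ₁` of its canonical pair. -/
def epsInv (f g : VF M) : M → ℝ := lamFun (canF f g) (canG f g) 0

/-- The curvature `κ` of `(f, g)`, i.e. `k₁` of its canonical pair. -/
def kappaInv (f g : VF M) : M → ℝ := kFun (canF f g) (canG f g) 0

/-- The centro-affine curvature `ν` of `(f, g)`, i.e. `λ₃` of its canonical pair. -/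
def nuInv (f g : VF M) : M → ℝ := lamFun (canF f g) (canG f g) 2

/-- The triviality conditions `κ = 0`, `L_{f_c} ν = 0`, `L_{[f_c,g_c]} ν = 0`. -/
def TrivialityConditions (f g : VF M) : Prop :=
  ∀ ξ, kappaInv f g ξ = 0 ∧ lieD (canF f g) (nuInv f g) ξ = 0 ∧
    lieD (br (canF f g) (canG f g)) (nuInv f g) ξ = 0

/-- Local diffeomorphisms from an open subset `φ.source` of `M` onto an open subset `φ.target`
of `ℝ³`, with coordinates `(x, y, w)` on `ℝ³` of indices `0, 1, 2`. -/
abbrev LocalDiffeo (M : Type*) [TopologicalSpace M] [ChartedSpace E3 M] : Type _ :=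
  PartialDiffeomorph (𝓡 3) (𝓡 3) M E3 ∞

/-- `φ_* f = f'` on the domain of `φ`. -/
def PushesTo (φ : LocalDiffeo M) (f : VF M) (f' : VF E3) : Prop :=
  ∀ ξ ∈ φ.source, mfderiv (𝓡 3) (𝓡 3) φ ξ (f ξ) = f' (φ ξ)

/-- `φ`, together with a feedback `(α, β)`, transforms the system `(f, g)` on `φ.source` into
the system `(f', g')` on `φ.target`. -/
def FeedbackEquivVia (φ : LocalDiffeo M) (f g : VF M) (f' g' : VF E3) : Prop :=
  ∃ α β : M → ℝ, ContMDiffOn (𝓡 3) 𝓘(ℝ, ℝ) ∞ α φ.source ∧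
    ContMDiffOn (𝓡 3) 𝓘(ℝ, ℝ) ∞ β φ.source ∧ (∀ ξ ∈ φ.source, β ξ ≠ 0) ∧
    PushesTo φ (fun ξ => f ξ + α ξ • g ξ) f' ∧ PushesTo φ (fun ξ => β ξ • g ξ) g'

/-- The set of values of the coordinate `w` on the range of `φ`. -/
def wRange (φ : LocalDiffeo M) : Set ℝ := (fun p : E3 => p 2) '' φ.target

end Systems

/-- The Wronskian `W(F, G) = F' G - F G'`. -/
def wronsk (F G : ℝ → ℝ) (w : ℝ) : ℝ := deriv F w * G w - F w * deriv G w

/-- The drift of the trivial system `ẋ = F₁(w), ẏ = F₂(w), ẇ = u`. -/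
def trivF (F₁ F₂ : ℝ → ℝ) : VF E3 := fun p => (!₂[F₁ (p 2), F₂ (p 2), 0] : E3)

/-- The control vector field of the trivial system `ẋ = F₁(w), ẏ = F₂(w), ẇ = u`. -/
def trivG : VF E3 := fun _ => (!₂[0, 0, 1] : E3)

/-- The drift of the system `ẋ = 1 + ε y u, ẏ = (x - ν(w) y) u, ẇ = u`. -/
def secF : VF E3 := fun _ => (!₂[1, 0, 0] : E3)

/-- The control vector field of the system `ẋ = 1 + ε y u, ẏ = (x - ν(w) y) u, ẇ = u`. -/
def secG (ε : ℝ) (ν : ℝ → ℝ) : VF E3 := fun p => (!₂[ε * p 1, p 0 - ν (p 2) * p 1, 1] : E3)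

end

end TrivialControl

open TrivialControl

namespace TrivialControl

open Set Filter Topology VectorField

/-! Write f, g for the canonical pair and h = [g,f]. Since k₃ = κ = 0, one has [f,h] = -k₂ h, and
[g,h] = ε f + λ₂ g + ν h with ε locally constant. As L_f ν = 0, the f-component of the Jacobi
identity reads k₂ ε = 0 and the h-component reads λ₂ = L_g k₂. Hence [g,f] = h, [f,h] = 0 and [g,h]
= ε f + ν h (`brackets_of_canonical`).

No bracket of this frame has a g-component, so the 1-form with values 0, 1, 0 on f, g, h is closed
and has a local primitive w. Since f and h annihilate ν, locally ν = N(w)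
(`exists_eq_comp_of_ker_le`). The 1-form with values F(w), 0, F'(w) on f, g, h is closed as soon as
F'' = ε F + N F'. Two independent solutions F₁, F₂ therefore give coordinates (x, y, w) in which f =
F₁ ∂x + F₂ ∂y and g = ∂w. This is the first canonical form, and it is also a system (T). The
explicit map `secToTriv` links the second canonical form to it (`exists_normal_forms`).

Passing to the canonical pair rests on the feedback laws λ₁ ↦ β² λ₁ and k₃ ↦ (k₃ - α)/β
(`feedback_structure`). Structure functions are natural under diffeomorphisms (`kFun_push`,
`lamFun_push`), so all computations take place on open subsets of ℝ³. For an arbitrary (T) the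
formulas follow by Cramer's rule from [g,f] = (F₁', F₂', 0) and [g,[g,f]] = (F₁'', F₂'', 0)
(`trivial_structure`). -/

theorem coords_map {V W : Type*} [AddCommGroup V] [Module ℝ V] [AddCommGroup W] [Module ℝ W]
    (T : V →ₗ[ℝ] W) (hT : Function.Injective T) (b : Fin 3 → V) (v : V) :
    coords (fun i => T (b i)) (T v) = coords b v := by
  -- The two predicates under `Classical.epsilon` coincide, so the same value is chosen, even for
  -- families that are not bases.
  have h : (fun c : Fin 3 → ℝ => ∑ i, c i • T (b i) = T v) = fun c => ∑ i, c i • b i = v := by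
    funext c
    rw [← hT.eq_iff (a := ∑ i, c i • b i)]
    simp [map_sum]
  unfold coords
  rw [h]

/-! ### Naturality of brackets, frames and structure functions under local diffeomorphisms. -/

section Naturality

variable {M : Type*} [TopologicalSpace M] [ChartedSpace E3 M]

/-- The differential of a local diffeomorphism. -/
noncomputable def LocalDiffeo.tangentEquiv (φ : LocalDiffeo M) {ξ : M} (hξ : ξ ∈ φ.source) :
    TangentSpace (𝓡 3) ξ ≃L[ℝ] TangentSpace (𝓡 3) (φ ξ) :=
  (φ.isLocalDiffeomorphAt _ _ _ hξ).mfderivToContinuousLinearEquiv (by simp)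

theorem LocalDiffeo.coe_tangentEquiv (φ : LocalDiffeo M) {ξ : M} (hξ : ξ ∈ φ.source) :
    (φ.tangentEquiv hξ : TangentSpace (𝓡 3) ξ →L[ℝ] TangentSpace (𝓡 3) (φ ξ)) =
      mfderiv (𝓡 3) (𝓡 3) φ ξ := rfl

theorem LocalDiffeo.contMDiffAt (φ : LocalDiffeo M) {ξ : M} (hξ : ξ ∈ φ.source) :
    ContMDiffAt (𝓡 3) (𝓡 3) ∞ φ ξ :=
  φ.contMDiffOn_toFun.contMDiffAt (φ.open_source.mem_nhds hξ)

/-- The image of a vector field under a local diffeomorphism. -/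
noncomputable def pushVF (φ : LocalDiffeo M) (f : VF M) : VF E3 := fun p =>
  (mfderiv (𝓡 3) (𝓡 3) φ (φ.invFun p) (f (φ.invFun p)) : E3)

theorem pushesTo_pushVF (φ : LocalDiffeo M) (f : VF M) : PushesTo φ f (pushVF φ f) := by
  intro ξ hξ
  have h : φ.invFun (φ ξ) = ξ := φ.left_inv hξ
  unfold pushVF
  rw [h]

theorem PushesTo.eq_mpullback {φ : LocalDiffeo M} {f : VF M} {f' : VF E3} (h : PushesTo φ f f')
    {ξ : M} (hξ : ξ ∈ φ.source) : f ξ = VectorField.mpullback (𝓡 3) (𝓡 3) φ f' ξ := by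
  rw [VectorField.mpullback_apply, ← h ξ hξ, ← φ.coe_tangentEquiv hξ,
    ContinuousLinearMap.inverse_equiv]
  exact ((φ.tangentEquiv hξ).symm_apply_apply _).symm

variable [IsManifold (𝓡 3) ∞ M]

/-- Near ξ the fields on `M` are the pullbacks of `f'` and `g'`, and pullback commutes with the Lie
bracket; applying the differential of `φ` undoes the pullback. -/
theorem PushesTo.br {φ : LocalDiffeo M} {f g : VF M} {f' g' : VF E3}
    (hf : PushesTo φ f f') (hg : PushesTo φ g g')
    (hf' : ContDiffOn ℝ ∞ (f' : E3 → E3) φ.target)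
    (hg' : ContDiffOn ℝ ∞ (g' : E3 → E3) φ.target) :
    PushesTo φ (br f g) (br f' g') := by
  intro ξ hξ
  have hφξ : φ ξ ∈ φ.target := φ.map_source hξ
  have hd : ∀ v : VF E3, ContDiffOn ℝ ∞ (v : E3 → E3) φ.target →
      MDifferentiableAt (𝓡 3) (𝓡 3).tangent
        (fun p => (⟨p, v p⟩ : TangentBundle (𝓡 3) E3)) (φ ξ) := fun v hv =>
    (contMDiffAt_vectorSpace_iff_contDiffAt.2
      (hv.contDiffAt (φ.open_target.mem_nhds hφξ))).mdifferentiableAt (by simp)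
  have e : ∀ (v : VF M) (v' : VF E3), PushesTo φ v v' →
      v =ᶠ[𝓝 ξ] VectorField.mpullback (𝓡 3) (𝓡 3) φ v' := fun v v' hv =>
    Filter.eventually_of_mem (φ.open_source.mem_nhds hξ) fun η hη => hv.eq_mpullback hη
  have h2 : (2 : ℕ∞ω) ≤ ∞ := WithTop.coe_le_coe.2 (le_top : (2 : ℕ∞) ≤ ⊤)
  have : IsManifold (𝓡 3) (minSmoothness ℝ 2) M := by
    rw [minSmoothness_of_isRCLikeNormedField]
    exact IsManifold.of_le h2
  have h1 : TrivialControl.br f g ξ = VectorField.mpullback (𝓡 3) (𝓡 3) φ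
      (TrivialControl.br f' g') ξ := by
    unfold TrivialControl.br
    rw [(e f f' hf).mlieBracket_vectorField_eq (e g g' hg)]
    exact (VectorField.mpullback_mlieBracket (n := ∞) (hd f' hf') (hd g' hg') (φ.contMDiffAt hξ)
      (by simpa using h2)).symm
  rw [h1, VectorField.mpullback_apply, ← φ.coe_tangentEquiv hξ, ContinuousLinearMap.inverse_equiv]
  exact (φ.tangentEquiv hξ).apply_symm_apply _

variable {φ : LocalDiffeo M} {f g : VF M} {f' g' : VF E3}
  (hf : PushesTo φ f f') (hg : PushesTo φ g g')
  (hf' : ContDiffOn ℝ ∞ (f' : E3 → E3) φ.target) (hg' : ContDiffOn ℝ ∞ (g' : E3 → E3) φ.target)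

theorem br_eq_lieBracket (v w : VF E3) :
    br v w = VectorField.lieBracket ℝ (v : E3 → E3) (w : E3 → E3) := by
  unfold br
  rw [← VectorField.mlieBracketWithin_univ, VectorField.mlieBracketWithin_eq_lieBracketWithin]
  exact VectorField.lieBracketWithin_univ

theorem contDiffOn_br {U : Set E3} (hU : IsOpen U) {v w : VF E3}
    (hv : ContDiffOn ℝ ∞ (v : E3 → E3) U) (hw : ContDiffOn ℝ ∞ (w : E3 → E3) U) :
    ContDiffOn ℝ ∞ (br v w : E3 → E3) U := by
  rw [br_eq_lieBracket]
  intro p hp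
  exact ((hv.contDiffAt (hU.mem_nhds hp)).lieBracket_vectorField
    (hw.contDiffAt (hU.mem_nhds hp)) (m := ∞) (by simp)).contDiffWithinAt

include hf hg hf' hg' in
theorem frameA_push {ξ : M} (hξ : ξ ∈ φ.source) :
    frameA f' g' (φ ξ) = fun i => φ.tangentEquiv hξ (frameA f g ξ i) := by
  funext i
  fin_cases i
  · exact (hf ξ hξ).symm
  · exact (hg ξ hξ).symm
  · exact (hg.br hf hg' hf' ξ hξ).symm

include hf hg hf' hg' in
theorem frameB_push {ξ : M} (hξ : ξ ∈ φ.source) :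
    frameB f' g' (φ ξ) = fun i => φ.tangentEquiv hξ (frameB f g ξ i) := by
  funext i
  fin_cases i
  · exact (hg ξ hξ).symm
  · exact (hg.br hf hg' hf' ξ hξ).symm
  · exact (hg.br (hg.br hf hg' hf') hg' (contDiffOn_br φ.open_target hg' hf') ξ hξ).symm

include hf hg hf' hg' in
theorem kFun_push {ξ : M} (hξ : ξ ∈ φ.source) (i : Fin 3) :
    kFun f' g' i (φ ξ) = kFun f g i ξ := by
  unfold kFun
  rw [frameB_push hf hg hf' hg' hξ,
    ← (hf.br (hf.br hg hf' hg') hf' (contDiffOn_br φ.open_target hf' hg') ξ hξ)]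
  exact congrFun (coords_map (φ.tangentEquiv hξ).toLinearMap (φ.tangentEquiv hξ).injective _ _) i

include hf hg hf' hg' in
theorem lamFun_push {ξ : M} (hξ : ξ ∈ φ.source) (i : Fin 3) :
    lamFun f' g' i (φ ξ) = lamFun f g i ξ := by
  unfold lamFun
  rw [frameA_push hf hg hf' hg' hξ,
    ← (hg.br (hg.br hf hg' hf') hg' (contDiffOn_br φ.open_target hg' hf') ξ hξ)]
  exact congrFun (coords_map (φ.tangentEquiv hξ).toLinearMap (φ.tangentEquiv hξ).injective _ _) i

omit [IsManifold (𝓡 3) ∞ M] in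
theorem linearIndependent_push {ξ : M} (hξ : ξ ∈ φ.source) (b : Fin 3 → TangentSpace (𝓡 3) ξ) :
    LinearIndependent ℝ (fun i => φ.tangentEquiv hξ (b i)) ↔ LinearIndependent ℝ b :=
  LinearMap.linearIndependent_iff (φ.tangentEquiv hξ).toLinearMap
    (LinearMap.ker_eq_bot.2 (φ.tangentEquiv hξ).injective)

include hf hg hf' hg' in
theorem regularOn_push : RegularOn f' g' φ.target ↔ RegularOn f g φ.source := by
  have key : ∀ ξ ∈ φ.source, (LinearIndependent ℝ (frameA f' g' (φ ξ)) ∧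
      LinearIndependent ℝ (frameB f' g' (φ ξ))) ↔ (LinearIndependent ℝ (frameA f g ξ) ∧
      LinearIndependent ℝ (frameB f g ξ)) := fun ξ hξ => by
    rw [frameA_push hf hg hf' hg' hξ, frameB_push hf hg hf' hg' hξ, linearIndependent_push,
      linearIndependent_push]
  constructor
  · exact fun h ξ hξ => (key ξ hξ).1 (h _ (φ.map_source hξ))
  · intro h p hp
    have := (key _ (φ.map_target hp)).2 (h _ (φ.map_target hp))
    rwa [φ.toPartialEquiv.right_inv hp] at this

include hf hg hf' hg' in
theorem canF_push : PushesTo φ (canF f g) (canF f' g') := by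
  intro ξ hξ
  unfold canF
  rw [map_add, map_smul, hf ξ hξ, hg ξ hξ, kFun_push hf hg hf' hg' hξ]

include hf hg hf' hg' in
theorem canG_push : PushesTo φ (canG f g) (canG f' g') := by
  intro ξ hξ
  unfold canG
  rw [map_smul, hg ξ hξ, lamFun_push hf hg hf' hg' hξ]

omit [IsManifold (𝓡 3) ∞ M] in
include hf in
theorem lieD_push {k : M → ℝ} {k' : E3 → ℝ} (hk : ∀ ξ ∈ φ.source, k' (φ ξ) = k ξ)
    (hk' : DifferentiableOn ℝ k' φ.target) {ξ : M} (hξ : ξ ∈ φ.source) :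
    fderiv ℝ k' (φ ξ) (f' (φ ξ)) = lieD f k ξ := by
  have e : k =ᶠ[𝓝 ξ] k' ∘ φ :=
    Filter.eventually_of_mem (φ.open_source.mem_nhds hξ) fun η hη => (hk η hη).symm
  unfold lieD
  have hd : DifferentiableAt ℝ k' (φ ξ) :=
    hk'.differentiableAt (φ.open_target.mem_nhds (φ.map_source hξ))
  rw [e.mfderiv_eq, mfderiv_comp ξ hd.mdifferentiableAt (φ.mdifferentiableAt (by simp) hξ),
    mfderiv_eq_fderiv, ← hf ξ hξ]
  rfl

include hf in
-- On the target, `f'` is forced to be the composite of `φ.invFun`, the section `f` and the tangent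
-- map of `φ`, all smooth.
theorem contDiffOn_push (hfs : SmoothVF f) : ContDiffOn ℝ ∞ (f' : E3 → E3) φ.target := by
  have h : ContMDiffOn (𝓡 3) (𝓡 3).tangent ∞
      (fun p => (⟨p, f' p⟩ : TangentBundle (𝓡 3) E3)) φ.target := by
    have h1 : ∀ ξ ∈ φ.source, (⟨φ ξ, f' (φ ξ)⟩ : TangentBundle (𝓡 3) E3) =
        tangentMap (𝓡 3) (𝓡 3) φ ⟨ξ, f ξ⟩ := fun ξ hξ => by
      rw [← hf ξ hξ]; rfl
    have h2 : ContMDiffOn (𝓡 3).tangent (𝓡 3).tangent ∞ (tangentMapWithin (𝓡 3) (𝓡 3) φ φ.source)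
        (Bundle.TotalSpace.proj ⁻¹' φ.source) :=
      φ.contMDiffOn_toFun.contMDiffOn_tangentMapWithin (by simp) φ.open_source.uniqueMDiffOn
    have h3 : ContMDiffOn (𝓡 3) (𝓡 3).tangent ∞
        (fun p => tangentMapWithin (𝓡 3) (𝓡 3) φ φ.source ⟨φ.invFun p, f (φ.invFun p)⟩)
        φ.target :=
      h2.comp (hfs.comp_contMDiffOn φ.contMDiffOn_invFun) fun p hp => φ.map_target hp
    refine h3.congr fun p hp => ?_
    have hm := φ.map_target hp
    have := h1 _ hm
    rw [φ.toPartialEquiv.right_inv hp] at this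
    refine this.trans (Eq.symm ?_)
    exact tangentMapWithin_eq_tangentMap (φ.open_source.uniqueMDiffOn _ hm)
      (φ.mdifferentiableAt (by simp) hm)
  exact contMDiffOn_vectorSpace_iff_contDiffOn.1 h

omit [IsManifold (𝓡 3) ∞ M] in
theorem PushesTo.trans {ψ : LocalDiffeo E3} {f'' : VF E3} (h : PushesTo φ f f')
    (h' : PushesTo ψ f' f'') : PushesTo (PartialDiffeomorph.trans φ ψ) f f'' := by
  intro ξ hξ
  have h1 : ξ ∈ φ.source := hξ.1
  have h2 : φ ξ ∈ ψ.source := hξ.2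
  change mfderiv (𝓡 3) (𝓡 3) (ψ ∘ φ) ξ (f ξ) = f'' (ψ (φ ξ))
  rw [mfderiv_comp ξ (ψ.mdifferentiableAt (by simp) h2) (φ.mdifferentiableAt (by simp) h1),
    ← h' _ h2, ← h ξ h1]
  rfl

theorem PushesTo.symm {ψ : LocalDiffeo E3} {v v' : VF E3} (h : PushesTo ψ v v') :
    PushesTo (PartialDiffeomorph.symm ψ) v' v := by
  intro p hp
  have h1 : ψ.invFun p ∈ ψ.source := ψ.map_target hp
  have h2 : ψ (ψ.invFun p) = p := ψ.right_inv hp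
  have h3 := h _ h1
  have h4 : MDifferentiableAt (𝓡 3) (𝓡 3) ψ.invFun p :=
    (PartialDiffeomorph.symm ψ).mdifferentiableAt (by simp) hp
  have h5 : MDifferentiableAt (𝓡 3) (𝓡 3) ψ (ψ.invFun p) := ψ.mdifferentiableAt (by simp) h1
  have e : ψ.invFun ∘ ψ =ᶠ[𝓝 (ψ.invFun p)] id :=
    Filter.eventually_of_mem (ψ.open_source.mem_nhds h1) fun q hq => ψ.left_inv hq
  have h6 := e.mfderiv_eq (I := 𝓡 3) (I' := 𝓡 3)
  rw [mfderiv_comp _ (by rw [h2]; exact h4) h5, mfderiv_id] at h6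
  have h7 := congrArg (fun T => T (v (ψ.invFun p))) h6
  change mfderiv (𝓡 3) (𝓡 3) ψ.invFun (ψ (ψ.invFun p))
    (mfderiv (𝓡 3) (𝓡 3) ψ (ψ.invFun p) (v (ψ.invFun p))) = v (ψ.invFun p) at h7
  rw [h3, h2] at h7
  exact h7

end Naturality

/-- A chart, as a local diffeomorphism. -/
noncomputable def chartDiffeo {M : Type*} [TopologicalSpace M] [ChartedSpace E3 M]
    [IsManifold (𝓡 3) ∞ M] (ξ : M) : LocalDiffeo M where
  toPartialEquiv := (chartAt E3 ξ).toPartialEquiv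
  open_source := (chartAt E3 ξ).open_source
  open_target := (chartAt E3 ξ).open_target
  contMDiffOn_toFun := contMDiffOn_chart
  contMDiffOn_invFun := contMDiffOn_chart_symm

/-! ### Coordinates in a frame and their smooth dependence on the point. -/

section LinearAlgebra

variable {V : Type*} [AddCommGroup V] [Module ℝ V]

theorem linearIndependent_triple {u v w : V} :
    LinearIndependent ℝ ![u, v, w] ↔
      ∀ a b c : ℝ, a • u + b • v + c • w = 0 → a = 0 ∧ b = 0 ∧ c = 0 := by
  rw [Fintype.linearIndependent_iff]
  constructor
  · intro h a b c habc
    have := h ![a, b, c] (by simpa [Fin.sum_univ_three] using habc)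
    exact ⟨this 0, this 1, this 2⟩
  · intro h c hc i
    have := h (c 0) (c 1) (c 2) (by simpa [Fin.sum_univ_three] using hc)
    fin_cases i
    exacts [this.1, this.2.1, this.2.2]

theorem coords_triple {u v w x : V} (h : LinearIndependent ℝ ![u, v, w]) {a b c : ℝ}
    (hx : x = a • u + b • v + c • w) : coords ![u, v, w] x = ![a, b, c] := by
  have := coords_unique h ![a, b, c]
  rw [← this]
  congr 1
  simpa [Fin.sum_univ_three] using hx

theorem eq_coords_triple (hV : Module.finrank ℝ V = 3) {u v w : V}
    (h : LinearIndependent ℝ ![u, v, w]) (x : V) :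
    x = coords ![u, v, w] x 0 • u + coords ![u, v, w] x 1 • v + coords ![u, v, w] x 2 • w := by
  have := sum_coords hV h x
  simpa [Fin.sum_univ_three] using this.symm

end LinearAlgebra

/-- The linear map `c ↦ ∑ i, c i • b i`. -/
noncomputable def frameMap (b : Fin 3 → E3) : (Fin 3 → ℝ) →L[ℝ] E3 :=
  ∑ i, (ContinuousLinearMap.proj (R := ℝ) (φ := fun _ : Fin 3 => ℝ) i).smulRight (b i)

theorem frameMap_apply (b : Fin 3 → E3) (c : Fin 3 → ℝ) : frameMap b c = ∑ i, c i • b i := by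
  simp [frameMap]

theorem frameMap_isInvertible {b : Fin 3 → E3} (hb : LinearIndependent ℝ b) :
    (frameMap b).IsInvertible := by
  have hinj : Function.Injective (frameMap b).toLinearMap := by
    rw [← LinearMap.ker_eq_bot, LinearMap.ker_eq_bot']
    intro c hc
    funext i
    exact Fintype.linearIndependent_iff.1 hb c ((frameMap_apply b c).symm.trans hc) i
  refine ⟨(LinearEquiv.ofInjectiveOfFinrankEq _ hinj (by simp)).toContinuousLinearEquiv, ?_⟩
  ext c
  rfl

theorem frameMap_inverse_apply {b : Fin 3 → E3} (hb : LinearIndependent ℝ b) (v : E3) :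
    (frameMap b).inverse v = coords b v := by
  obtain ⟨e, he⟩ := frameMap_isInvertible hb
  have h : frameMap b (coords b v) = v := by
    rw [frameMap_apply]
    exact sum_coords (by simp) hb v
  rw [← he, ContinuousLinearMap.inverse_equiv]
  exact (e.symm_apply_eq).2 (by rw [← he] at h; exact h.symm)

/-- Inversion of continuous linear maps is smooth at invertible ones. This is what makes the
coefficients given by `coords`, defined by choice at each point, smooth functions. -/
theorem contDiffOn_frameMap_inverse {U : Set E3} {b : Fin 3 → E3 → E3}
    (hb : ∀ i, ContDiffOn ℝ ∞ (b i) U) (hli : ∀ p ∈ U, LinearIndependent ℝ (fun i => b i p)) :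
    ContDiffOn ℝ ∞ (fun p => (frameMap (fun i => b i p)).inverse) U := by
  have h1 : ContDiffOn ℝ ∞ (fun p => frameMap (fun i => b i p)) U := by
    unfold frameMap
    refine ContDiffOn.sum fun i _ => ?_
    exact (ContinuousLinearMap.smulRightL ℝ (Fin 3 → ℝ) E3
      (ContinuousLinearMap.proj i)).contDiff.comp_contDiffOn (hb i)
  intro p hp
  exact ((frameMap_isInvertible (hli p hp)).contDiffAt_map_inverse).comp_contDiffWithinAt p (h1 p hp)

theorem contDiffOn_coords {U : Set E3} {b : Fin 3 → E3 → E3} {v : E3 → E3}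
    (hb : ∀ i, ContDiffOn ℝ ∞ (b i) U) (hli : ∀ p ∈ U, LinearIndependent ℝ (fun i => b i p))
    (hv : ContDiffOn ℝ ∞ v U) (i : Fin 3) :
    ContDiffOn ℝ ∞ (fun p => coords (fun i => b i p) (v p) i) U := by
  have h : ContDiffOn ℝ ∞ (fun p => (frameMap (fun i => b i p)).inverse (v p)) U :=
    (contDiffOn_frameMap_inverse hb hli).clm_apply hv
  refine (contDiffOn_pi.1 h i).congr fun p hp => ?_
  rw [frameMap_inverse_apply (hli p hp)]

/-! ### Structure functions on open subsets of ℝ³, in terms of `lieBracket`. -/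

section Fields

variable {U : Set E3} (hU : IsOpen U) {f g : E3 → E3}
  (hf : ContDiffOn ℝ ∞ f U) (hg : ContDiffOn ℝ ∞ g U)

include hU in
theorem contDiffOn_lieBracket (hf : ContDiffOn ℝ ∞ f U) (hg : ContDiffOn ℝ ∞ g U) :
    ContDiffOn ℝ ∞ (lieBracket ℝ f g) U := fun p hp =>
  ((hf.contDiffAt (hU.mem_nhds hp)).lieBracket_vectorField
    (hg.contDiffAt (hU.mem_nhds hp)) (m := ∞) (by simp)).contDiffWithinAt

theorem frameA_eq (f g : E3 → E3) (p : E3) :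
    frameA (M := E3) f g p = (![f p, g p, lieBracket ℝ g f p] : Fin 3 → E3) := by
  funext i
  fin_cases i
  exacts [rfl, rfl, congrFun (br_eq_lieBracket g f) p]

theorem br_br_eq_lieBracket (u v w : E3 → E3) (p : E3) :
    br (M := E3) u (br (M := E3) v w) p = lieBracket ℝ u (lieBracket ℝ v w) p :=
  (congrFun (br_eq_lieBracket u _) p).trans
    (congrArg (fun X : E3 → E3 => lieBracket ℝ u X p) (br_eq_lieBracket v w))

theorem frameB_eq (f g : E3 → E3) (p : E3) :
    frameB (M := E3) f g p =
      (![g p, lieBracket ℝ g f p, lieBracket ℝ g (lieBracket ℝ g f) p] : Fin 3 → E3) := by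
  funext i
  fin_cases i
  exacts [rfl, congrFun (br_eq_lieBracket g f) p, br_br_eq_lieBracket g g f p]

theorem lieBracket_lieBracket_swap (f g : E3 → E3) (p : E3) :
    lieBracket ℝ f (lieBracket ℝ f g) p = - lieBracket ℝ f (lieBracket ℝ g f) p := by
  have : lieBracket ℝ f g = - lieBracket ℝ g f := by
    funext q
    exact lieBracket_swap
  rw [this]
  simp only [lieBracket, Pi.neg_apply, map_neg]
  rw [fderiv_neg]
  simp
  abel

theorem kFun_eq (f g : E3 → E3) (i : Fin 3) (p : E3) :
    kFun (M := E3) f g i p =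
      coords (V := E3) ![g p, lieBracket ℝ g f p, lieBracket ℝ g (lieBracket ℝ g f) p]
        (-lieBracket ℝ f (lieBracket ℝ g f) p) i :=
  congrArg₂ (fun b v => coords (V := E3) b v i) (frameB_eq f g p)
    ((br_br_eq_lieBracket f f g p).trans (lieBracket_lieBracket_swap f g p))

theorem lamFun_eq (f g : E3 → E3) (i : Fin 3) (p : E3) :
    lamFun (M := E3) f g i p =
      coords (V := E3) ![f p, g p, lieBracket ℝ g f p] (lieBracket ℝ g (lieBracket ℝ g f) p) i :=
  congrArg₂ (fun b v => coords (V := E3) b v i) (frameA_eq f g p) (br_br_eq_lieBracket g g f p)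

theorem regularOn_iff (f g : E3 → E3) (U : Set E3) :
    RegularOn (M := E3) f g U ↔ ∀ p ∈ U,
      LinearIndependent ℝ (![f p, g p, lieBracket ℝ g f p] : Fin 3 → E3) ∧
      LinearIndependent ℝ
        (![g p, lieBracket ℝ g f p, lieBracket ℝ g (lieBracket ℝ g f) p] : Fin 3 → E3) := by
  refine forall₂_congr fun p _ => ?_
  rw [frameA_eq, frameB_eq]
  rfl

theorem lieBracket_eq_lam {p : E3}
    (h : LinearIndependent ℝ (![f p, g p, lieBracket ℝ g f p] : Fin 3 → E3)) :
    lieBracket ℝ g (lieBracket ℝ g f) p = lamFun (M := E3) f g 0 p • f p +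
      lamFun (M := E3) f g 1 p • g p + lamFun (M := E3) f g 2 p • lieBracket ℝ g f p := by
  simp only [lamFun_eq]
  exact eq_coords_triple (by simp) h _

theorem lieBracket_eq_k {p : E3}
    (h : LinearIndependent ℝ
      (![g p, lieBracket ℝ g f p, lieBracket ℝ g (lieBracket ℝ g f) p] : Fin 3 → E3)) :
    -lieBracket ℝ f (lieBracket ℝ g f) p = kFun (M := E3) f g 0 p • g p +
      kFun (M := E3) f g 1 p • lieBracket ℝ g f p +
      kFun (M := E3) f g 2 p • lieBracket ℝ g (lieBracket ℝ g f) p := by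
  simp only [kFun_eq]
  exact eq_coords_triple (by simp) h _

include hU hf hg in
theorem contDiffOn_lamFun (hreg : RegularOn (M := E3) f g U) (i : Fin 3) :
    ContDiffOn ℝ ∞ (lamFun (M := E3) f g i) U := by
  have hh := contDiffOn_lieBracket hU hg hf
  have hk := contDiffOn_lieBracket hU hg hh
  have e : ∀ p, (fun i => (![f, g, lieBracket ℝ g f] : Fin 3 → E3 → E3) i p) =
      ![f p, g p, lieBracket ℝ g f p] := fun p => by
    funext i; fin_cases i <;> rfl
  have := contDiffOn_coords (U := U) (b := ![f, g, lieBracket ℝ g f])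
    (by intro i; fin_cases i; exacts [hf, hg, hh])
    (fun p hp => by rw [e]; exact ((regularOn_iff f g U).1 hreg p hp).1) hk i
  refine this.congr fun p _ => ?_
  rw [lamFun_eq, e]

include hU hf hg in
theorem contDiffOn_kFun (hreg : RegularOn (M := E3) f g U) (i : Fin 3) :
    ContDiffOn ℝ ∞ (kFun (M := E3) f g i) U := by
  have hh := contDiffOn_lieBracket hU hg hf
  have hk := contDiffOn_lieBracket hU hg hh
  have e : ∀ p, (fun i => (![g, lieBracket ℝ g f, lieBracket ℝ g (lieBracket ℝ g f)] :
      Fin 3 → E3 → E3) i p) =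
      ![g p, lieBracket ℝ g f p, lieBracket ℝ g (lieBracket ℝ g f) p] := fun p => by
    funext i; fin_cases i <;> rfl
  have := contDiffOn_coords (U := U)
    (b := ![g, lieBracket ℝ g f, lieBracket ℝ g (lieBracket ℝ g f)])
    (by intro i; fin_cases i; exacts [hg, hh, hk])
    (fun p hp => by rw [e]; exact ((regularOn_iff f g U).1 hreg p hp).2)
    (contDiffOn_lieBracket hU hf hh).neg i
  refine this.congr fun p _ => ?_
  rw [kFun_eq, e]

end Fields

/-! ### Transformation of λ₁ and k₃ under feedback. -/

section Feedback

variable {U : Set E3} (hU : IsOpen U) {f g : E3 → E3} {α β : E3 → ℝ}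
  (hf : ContDiffOn ℝ ∞ f U) (hg : ContDiffOn ℝ ∞ g U)
  (hα : ContDiffOn ℝ ∞ α U) (hβ : ContDiffOn ℝ ∞ β U)

theorem differentiableAt_of_mem {F : Type*} [NormedAddCommGroup F] [NormedSpace ℝ F] {k : E3 → F}
    (hU : IsOpen U) (hk : ContDiffOn ℝ ∞ k U) {p : E3} (hp : p ∈ U) : DifferentiableAt ℝ k p :=
  (hk.contDiffAt (hU.mem_nhds hp)).differentiableAt (by simp)

theorem contDiffOn_fderiv_apply {F : Type*} [NormedAddCommGroup F] [NormedSpace ℝ F] {k : E3 → F}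
    (hU : IsOpen U) (hk : ContDiffOn ℝ ∞ k U) (hf : ContDiffOn ℝ ∞ f U) :
    ContDiffOn ℝ ∞ (fun p => fderiv ℝ k p (f p)) U :=
  (hk.fderiv_of_isOpen hU (m := ∞) (by simp)).clm_apply hf

theorem lieBracket_add_smul_right {V W W' : E3 → E3} {a b : E3 → ℝ} {p : E3}
    (hW : DifferentiableAt ℝ W p) (hW' : DifferentiableAt ℝ W' p)
    (ha : DifferentiableAt ℝ a p) (hb : DifferentiableAt ℝ b p) :
    lieBracket ℝ V (fun q => a q • W q + b q • W' q) p =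
      fderiv ℝ a p (V p) • W p + a p • lieBracket ℝ V W p +
        (fderiv ℝ b p (V p) • W' p + b p • lieBracket ℝ V W' p) := by
  rw [← lieBracket_smul_right ha hW, ← lieBracket_smul_right hb hW']
  exact lieBracket_add_right (ha.smul hW) (hb.smul hW')

theorem lieBracket_add_smul_left {V W W' : E3 → E3} {a : E3 → ℝ} {p : E3}
    (hW : DifferentiableAt ℝ W p) (hW' : DifferentiableAt ℝ W' p)
    (ha : DifferentiableAt ℝ a p) :
    lieBracket ℝ (fun q => W q + a q • W' q) V p =
      lieBracket ℝ W V p + (-fderiv ℝ a p (V p) • W' p + a p • lieBracket ℝ W' V p) := by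
  have h := lieBracket_smul_left (W := V) ha hW'
  rw [neg_smul, ← neg_smul, ← h]
  exact lieBracket_add_left hW (ha.smul hW')

/-- The bracket `[β g, f + α g]` is a combination of `[g, f]` and `g`. -/
theorem lieBracket_feedback {p : E3} (hf : DifferentiableAt ℝ f p) (hg : DifferentiableAt ℝ g p)
    (hα : DifferentiableAt ℝ α p) (hβ : DifferentiableAt ℝ β p) :
    lieBracket ℝ (fun q => β q • g q) (fun q => f q + α q • g q) p =
      β p • lieBracket ℝ g f p +
        (β p * fderiv ℝ α p (g p) - fderiv ℝ β p (f p + α p • g p)) • g p := by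
  have h1 : lieBracket ℝ g (fun q => f q + α q • g q) p =
      lieBracket ℝ g f p + (fderiv ℝ α p (g p) • g p + α p • lieBracket ℝ g g p) := by
    rw [← lieBracket_smul_right hα hg]
    exact lieBracket_add_right hf (hα.smul hg)
  rw [lieBracket_smul_left hβ hg, h1, lieBracket_self]
  simp only [Pi.zero_apply]
  module

include hU hf hg hα hβ in
-- Only the leading terms matter: each new bracket is computed modulo g, or modulo g and [g,f], and
-- the remaining coefficients are left existential.
theorem exists_feedback_brackets :
    ∀ p ∈ U, ∃ c a b a' b' : ℝ,
      lieBracket ℝ (fun q => β q • g q) (fun q => f q + α q • g q) p =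
        β p • lieBracket ℝ g f p + c • g p ∧
      lieBracket ℝ (fun q => β q • g q)
        (lieBracket ℝ (fun q => β q • g q) (fun q => f q + α q • g q)) p =
        (β p) ^ 2 • lieBracket ℝ g (lieBracket ℝ g f) p + a • lieBracket ℝ g f p + b • g p ∧
      lieBracket ℝ (fun q => f q + α q • g q)
        (lieBracket ℝ (fun q => β q • g q) (fun q => f q + α q • g q)) p =
        β p • lieBracket ℝ f (lieBracket ℝ g f) p +
          (α p * β p) • lieBracket ℝ g (lieBracket ℝ g f) p +
          a' • lieBracket ℝ g f p + b' • g p := by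
  set h := lieBracket ℝ g f with hh
  have hhs : ContDiffOn ℝ ∞ h U := contDiffOn_lieBracket hU hg hf
  set γ : E3 → ℝ := fun p => β p * fderiv ℝ α p (g p) - fderiv ℝ β p (f p + α p • g p) with hγ
  have hγs : ContDiffOn ℝ ∞ γ U :=
    (hβ.mul (contDiffOn_fderiv_apply hU hα hg)).sub
      (contDiffOn_fderiv_apply hU hβ (hf.add (hα.smul hg)))
  intro p hp
  have df := differentiableAt_of_mem hU hf hp
  have dg := differentiableAt_of_mem hU hg hp
  have da := differentiableAt_of_mem hU hα hp
  have db := differentiableAt_of_mem hU hβ hp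
  have dc := differentiableAt_of_mem hU hγs hp
  have dh := differentiableAt_of_mem hU hhs hp
  have e : lieBracket ℝ (fun q => β q • g q) (fun q => f q + α q • g q) =ᶠ[𝓝 p]
      fun q => β q • h q + γ q • g q :=
    eventually_of_mem (hU.mem_nhds hp) fun q hq =>
      lieBracket_feedback (differentiableAt_of_mem hU hf hq) (differentiableAt_of_mem hU hg hq)
        (differentiableAt_of_mem hU hα hq) (differentiableAt_of_mem hU hβ hq)
  have hfg : lieBracket ℝ f g p = - h p := lieBracket_swap
  refine ⟨γ p, β p * fderiv ℝ β p (g p), β p * fderiv ℝ γ p (g p) -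
      fderiv ℝ β p (β p • h p + γ p • g p),
    fderiv ℝ β p (f p) - γ p + α p * fderiv ℝ β p (g p),
    fderiv ℝ γ p (f p) - fderiv ℝ α p (β p • h p + γ p • g p) + α p * fderiv ℝ γ p (g p),
    e.self_of_nhds, ?_, ?_⟩
  · rw [EventuallyEq.rfl.lieBracket_vectorField_eq e, lieBracket_smul_left db dg,
      lieBracket_add_smul_right dh dg db dc, lieBracket_self]
    simp only [Pi.zero_apply]
    module
  · rw [EventuallyEq.rfl.lieBracket_vectorField_eq e, lieBracket_add_smul_left df dg da,
      lieBracket_add_smul_right dh dg db dc, lieBracket_add_smul_right dh dg db dc,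
      lieBracket_self, hfg]
    simp only [Pi.zero_apply]
    module

include hU hf hg hα hβ in
-- Modulo g and [g,f], the new [g,[g,f]] is β² times the old one, and the new -[f,[g,f]] is β (k₃ -
-- α) times the old [g,[g,f]]. The laws for λ₁ and k₃ are the resulting ratios, and they dictate the
-- feedback α = k₃, β = |λ₁|^(-1/2) of the canonical pair.
theorem feedback_structure (hβ0 : ∀ p ∈ U, β p ≠ 0) (hreg : RegularOn (M := E3) f g U) :
    RegularOn (M := E3) (fun q => f q + α q • g q) (fun q => β q • g q) U ∧
    ∀ p ∈ U,
      lamFun (M := E3) (fun q => f q + α q • g q) (fun q => β q • g q) 0 p =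
        β p ^ 2 * lamFun (M := E3) f g 0 p ∧
      kFun (M := E3) (fun q => f q + α q • g q) (fun q => β q • g q) 2 p =
        (kFun (M := E3) f g 2 p - α p) / β p := by
  suffices H : ∀ p ∈ U, (LinearIndependent ℝ (![f p + α p • g p, β p • g p,
        lieBracket ℝ (fun q => β q • g q) (fun q => f q + α q • g q) p] : Fin 3 → E3) ∧
      LinearIndependent ℝ (![β p • g p,
        lieBracket ℝ (fun q => β q • g q) (fun q => f q + α q • g q) p,
        lieBracket ℝ (fun q => β q • g q)
        (lieBracket ℝ (fun q => β q • g q) (fun q => f q + α q • g q)) p] : Fin 3 → E3)) ∧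
      lamFun (M := E3) (fun q => f q + α q • g q) (fun q => β q • g q) 0 p =
        β p ^ 2 * lamFun (M := E3) f g 0 p ∧
      kFun (M := E3) (fun q => f q + α q • g q) (fun q => β q • g q) 2 p =
        (kFun (M := E3) f g 2 p - α p) / β p from
    ⟨(regularOn_iff _ _ _).2 fun p hp => (H p hp).1, fun p hp => (H p hp).2⟩
  intro p hp
  obtain ⟨c, a, b, a', b', h1, h2, h3⟩ := exists_feedback_brackets hU hf hg hα hβ p hp
  obtain ⟨hA, hB⟩ := (regularOn_iff f g U).1 hreg p hp
  have hl := lieBracket_eq_lam hA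
  have hk := lieBracket_eq_k hB
  have b0 := hβ0 p hp
  have hA' : LinearIndependent ℝ (![f p + α p • g p, β p • g p,
        lieBracket ℝ (fun q => β q • g q) (fun q => f q + α q • g q) p] : Fin 3 → E3) := by
    rw [linearIndependent_triple] at hA ⊢
    intro x y z hxyz
    rw [h1] at hxyz
    obtain ⟨r1, r2, r3⟩ := hA x (x * α p + y * β p + z * c) (z * β p) (by rw [← hxyz]; module)
    have hz : z = 0 := by simpa [b0] using r3
    subst r1 hz
    exact ⟨rfl, by simpa [b0] using r2, rfl⟩
  have hB' : LinearIndependent ℝ (![β p • g p,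
        lieBracket ℝ (fun q => β q • g q) (fun q => f q + α q • g q) p,
        lieBracket ℝ (fun q => β q • g q)
        (lieBracket ℝ (fun q => β q • g q) (fun q => f q + α q • g q)) p] : Fin 3 → E3) := by
    rw [linearIndependent_triple] at hB ⊢
    intro x y z hxyz
    rw [h2, h1] at hxyz
    obtain ⟨r1, r2, r3⟩ := hB (x * β p + y * c + z * b) (y * β p + z * a) (z * β p ^ 2)
      (by rw [← hxyz]; module)
    have hz : z = 0 := by simpa [b0] using r3
    subst hz
    have hy : y = 0 := by simpa [b0] using r2
    subst hy
    exact ⟨by simpa [b0] using r1, rfl, rfl⟩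
  refine ⟨⟨hA', hB'⟩, ?_, ?_⟩
  · rw [lamFun_eq]
    set l0 := lamFun (M := E3) f g 0 p
    set l1 := lamFun (M := E3) f g 1 p
    set l2 := lamFun (M := E3) f g 2 p
    -- Only the first coefficient is wanted; the other two solve the triangular system, so that the
    -- full expansion can be exhibited.
    have := coords_triple hA' (x := lieBracket ℝ (fun q => β q • g q)
        (lieBracket ℝ (fun q => β q • g q) (fun q => f q + α q • g q)) p)
      (a := β p ^ 2 * l0)
      (b := (β p ^ 2 * l1 + b - (β p * l2 + a / β p) * c - β p ^ 2 * l0 * α p) / β p)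
      (c := β p * l2 + a / β p)
      (by rw [h2, h1, hl]; (match_scalars <;> field_simp); ring)
    exact congrFun this 0
  · rw [kFun_eq]
    set k0 := kFun (M := E3) f g 0 p
    set k1 := kFun (M := E3) f g 1 p
    set k2 := kFun (M := E3) f g 2 p
    have hJ : lieBracket ℝ f (lieBracket ℝ g f) p = -(k0 • g p + k1 • lieBracket ℝ g f p +
        k2 • lieBracket ℝ g (lieBracket ℝ g f) p) := by rw [← hk, neg_neg]
    -- Back substitution: `z` is read off from the [g,[g,f]] component, then `y` from the [g,f]
    -- component.
    set z := (k2 - α p) / β p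
    set y := (β p * k1 - a' - z * a) / β p
    have hz : z * β p = k2 - α p := by simp only [z]; field_simp
    have hy : y * β p = β p * k1 - a' - z * a := by simp only [y]; field_simp
    have := coords_triple hB' (x := -lieBracket ℝ (fun q => f q + α q • g q)
        (lieBracket ℝ (fun q => β q • g q) (fun q => f q + α q • g q)) p)
      (a := (β p * k0 - b' - y * c - z * b) / β p)
      (b := y)
      (c := z) (by
        rw [h3, h2, h1, hJ]
        match_scalars
        · field_simp; ring
        · linear_combination -hy
        · linear_combination -(β p) * hz)
    exact congrFun this 2

end Feedback

/-! ### The canonical pair, and its brackets under the triviality conditions. -/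

section Canonical

variable {U : Set E3} (hU : IsOpen U) {f g : E3 → E3}
  (hf : ContDiffOn ℝ ∞ f U) (hg : ContDiffOn ℝ ∞ g U)

/-- If λ₁ vanished, [g,[g,f]] would lie in the span of g and [g,f], against the second regularity
assumption. -/
theorem lamFun_zero_ne_zero (hreg : RegularOn (M := E3) f g U) {p : E3} (hp : p ∈ U) :
    lamFun (M := E3) f g 0 p ≠ 0 := by
  obtain ⟨hA, hB⟩ := (regularOn_iff f g U).1 hreg p hp
  have hl := lieBracket_eq_lam hA
  intro h0
  rw [h0] at hl
  have := (linearIndependent_triple.1 hB) (lamFun (M := E3) f g 1 p) (lamFun (M := E3) f g 2 p) (-1)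
    (by rw [hl]; module)
  norm_num at this

include hU hf hg in
theorem contDiffOn_canF (hreg : RegularOn (M := E3) f g U) :
    ContDiffOn ℝ ∞ (canF (M := E3) f g : E3 → E3) U :=
  hf.add ((contDiffOn_kFun hU hf hg hreg 2).smul hg)

include hU hf hg in
theorem contDiffOn_abs_rpow_lamFun (hreg : RegularOn (M := E3) f g U) :
    ContDiffOn ℝ ∞ (fun p => |lamFun (M := E3) f g 0 p| ^ (-(1 / 2) : ℝ)) U := by
  intro p hp
  have h0 := lamFun_zero_ne_zero hreg hp
  have h1 := contDiffOn_lamFun hU hf hg hreg 0 p hp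
  exact ((contDiffAt_abs h0).comp_contDiffWithinAt p h1).rpow_const_of_ne (by simpa using h0)

include hU hf hg in
theorem contDiffOn_canG (hreg : RegularOn (M := E3) f g U) :
    ContDiffOn ℝ ∞ (canG (M := E3) f g : E3 → E3) U :=
  (contDiffOn_abs_rpow_lamFun hU hf hg hreg).smul hg

include hU hf hg in
theorem isCanonicalOn_can (hreg : RegularOn (M := E3) f g U) :
    IsCanonicalOn (M := E3) (canF (M := E3) f g) (canG (M := E3) f g) U := by
  have hpos : ∀ p ∈ U, 0 < |lamFun (M := E3) f g 0 p| := fun p hp =>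
    abs_pos.2 (lamFun_zero_ne_zero hreg hp)
  obtain ⟨h1, h2⟩ := feedback_structure hU hf hg (contDiffOn_kFun hU hf hg hreg 2)
    (contDiffOn_abs_rpow_lamFun hU hf hg hreg) (fun p hp => (Real.rpow_pos_of_pos (hpos p hp) _).ne')
    hreg
  refine ⟨h1, fun p hp => ⟨((h2 p hp).2).trans (by simp), ?_⟩⟩
  have h3 : (|lamFun (M := E3) f g 0 p| ^ (-(1 / 2) : ℝ)) ^ 2 * lamFun (M := E3) f g 0 p =
      |lamFun (M := E3) f g 0 p|⁻¹ * lamFun (M := E3) f g 0 p := by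
    rw [← Real.rpow_natCast, ← Real.rpow_mul (abs_nonneg _), ← Real.rpow_neg_one]
    norm_num
  have h4 : lamFun (M := E3) (canF (M := E3) f g) (canG (M := E3) f g) 0 p =
      |lamFun (M := E3) f g 0 p|⁻¹ * lamFun (M := E3) f g 0 p := ((h2 p hp).1).trans h3
  have h0 := lamFun_zero_ne_zero hreg hp
  rw [h4]
  rcases abs_choice (lamFun (M := E3) f g 0 p) with h | h <;> rw [h]
  · left; field_simp
  · right; field_simp

theorem eventually_eq_of_eq_one_or {l : E3 → ℝ} {p : E3} (hU : IsOpen U) (hl : ContinuousOn l U)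
    (h : ∀ q ∈ U, l q = 1 ∨ l q = -1) (hp : p ∈ U) : ∀ᶠ q in 𝓝 p, l q = l p := by
  have hc := hl.continuousAt (hU.mem_nhds hp)
  filter_upwards [hc.eventually (Metric.ball_mem_nhds (l p) one_pos), hU.mem_nhds hp] with q hq hqU
  rw [Real.dist_eq, abs_lt] at hq
  rcases h q hqU with h1 | h1 <;> rcases h p hp with h2 | h2 <;> rw [h1, h2] at hq ⊢ <;> norm_num at hq

include hU hf hg in
/-- Under the triviality conditions the frame `f`, `g`, `h = [g, f]` of a canonical pair satisfies
`[f, h] = 0` and `[g, h] = ε f + ν h`. -/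
theorem brackets_of_canonical (hcan : IsCanonicalOn (M := E3) f g U)
    (hκ : ∀ p ∈ U, kFun (M := E3) f g 0 p = 0)
    (hν : ∀ p ∈ U, fderiv ℝ (lamFun (M := E3) f g 2) p (f p) = 0) :
    ∀ p ∈ U, lieBracket ℝ f (lieBracket ℝ g f) p = 0 ∧
      lieBracket ℝ g (lieBracket ℝ g f) p = lamFun (M := E3) f g 0 p • f p +
        lamFun (M := E3) f g 2 p • lieBracket ℝ g f p := by
  obtain ⟨hreg, hcan⟩ := hcan
  set h := lieBracket ℝ g f with hh
  have hhs : ContDiffOn ℝ ∞ h U := contDiffOn_lieBracket hU hg hf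
  set l0 := lamFun (M := E3) f g 0
  set l1 := lamFun (M := E3) f g 1
  set l2 := lamFun (M := E3) f g 2
  set k := kFun (M := E3) f g 1
  have sl : ∀ i, ContDiffOn ℝ ∞ (lamFun (M := E3) f g i) U := contDiffOn_lamFun hU hf hg hreg
  have sk : ContDiffOn ℝ ∞ k U := contDiffOn_kFun hU hf hg hreg 1
  have hgh : ∀ p ∈ U, lieBracket ℝ g h p = l0 p • f p + l1 p • g p + l2 p • h p := fun p hp =>
    lieBracket_eq_lam ((regularOn_iff f g U).1 hreg p hp).1
  have hfh : ∀ p ∈ U, lieBracket ℝ f h p = (-k p) • h p := fun p hp => by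
    have := lieBracket_eq_k ((regularOn_iff f g U).1 hreg p hp).2
    rw [hκ p hp, (hcan p hp).1] at this
    have this : -lieBracket ℝ f h p = k p • h p := by simpa using this
    rw [neg_smul, ← this, neg_neg]
  have main : ∀ p ∈ U, k p = 0 ∧ l1 p = fderiv ℝ k p (g p) := by
    intro p hp
    have df := differentiableAt_of_mem hU hf hp
    have dg := differentiableAt_of_mem hU hg hp
    have dh := differentiableAt_of_mem hU hhs hp
    have dl := fun i => differentiableAt_of_mem hU (sl i) hp
    have dk := differentiableAt_of_mem hU sk hp
    -- A continuous function with values ±1 is locally constant.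
    have hl0 : fderiv ℝ l0 p = 0 := by
      have := eventually_eq_of_eq_one_or hU (sl 0).continuousOn (fun q hq => (hcan q hq).2) hp
      rw [EventuallyEq.fderiv_eq (f := fun _ => l0 p) this]
      simp
    have hfg : lieBracket ℝ f g = -h := by
      funext q
      exact lieBracket_swap
    have hhh : lieBracket ℝ (lieBracket ℝ f g) h p = 0 := by
      rw [hfg]
      simp [lieBracket, fderiv_neg]
    -- Jacobi identity [f,[g,h]] = [[f,g],h] + [g,[f,h]]; the middle term vanishes because [f,g] =
    -- -h.
    have J := leibniz_identity_lieBracket (n := ∞) (𝕜 := ℝ)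
      (by rw [minSmoothness_of_isRCLikeNormedField]; exact WithTop.coe_le_coe.2 le_top)
      (hf.contDiffAt (hU.mem_nhds hp)) (hg.contDiffAt (hU.mem_nhds hp))
      (hhs.contDiffAt (hU.mem_nhds hp))
    -- The factor 1 nests the three terms into two-term combinations, to which
    -- `lieBracket_add_smul_right` applies twice.
    have e1 : lieBracket ℝ g h =ᶠ[𝓝 p] fun q => (1 : ℝ) • (l0 q • f q + l1 q • g q) + l2 q • h q :=
      eventually_of_mem (hU.mem_nhds hp) fun q hq => by simpa using hgh q hq
    have e2 : lieBracket ℝ f h =ᶠ[𝓝 p] fun q => (-k q) • h q :=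
      eventually_of_mem (hU.mem_nhds hp) hfh
    rw [EventuallyEq.rfl.lieBracket_vectorField_eq e1, EventuallyEq.rfl.lieBracket_vectorField_eq e2,
      lieBracket_add_smul_right (W := fun q => l0 q • f q + l1 q • g q)
        (((dl 0).smul df).add ((dl 1).smul dg)) dh (differentiableAt_const _) (dl 2),
      lieBracket_add_smul_right df dg (dl 0) (dl 1), hhh, lieBracket_smul_right (f := fun q => -k q) dk.neg dh,
      hgh p hp, hfh p hp, hfg, hl0, hν p hp, lieBracket_self] at J
    have hk : fderiv ℝ (fun q => -k q) p (g p) = - fderiv ℝ k p (g p) := by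
      rw [fderiv_fun_neg]; rfl
    have hl1f : ∃ z : ℝ, fderiv ℝ l1 p (f p) = z := ⟨_, rfl⟩
    obtain ⟨z, hz⟩ := hl1f
    rw [hk, hz] at J
    -- The three coefficients are the components of the Jacobi identity along f, g and h.
    have := (linearIndependent_triple.1 ((regularOn_iff f g U).1 hreg p hp).1)
      (k p * l0 p) (z + k p * l1 p) (-l1 p + fderiv ℝ k p (g p)) (by
        rw [← sub_eq_zero] at J
        rw [← J]
        simp only [Pi.zero_apply, Pi.neg_apply, fderiv_fun_const, zero_apply]
        module)
    refine ⟨?_, by linarith [this.2.2]⟩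
    have h0 := lamFun_zero_ne_zero hreg hp
    simpa [l0, h0] using this.1
  intro p hp
  have hk0 : fderiv ℝ k p = 0 := by
    have : k =ᶠ[𝓝 p] fun _ => 0 := eventually_of_mem (hU.mem_nhds hp) fun q hq => (main q hq).1
    rw [this.fderiv_eq]
    simp
  have hl1 : l1 p = 0 := by rw [(main p hp).2, hk0]; rfl
  refine ⟨by rw [hfh p hp, (main p hp).1]; simp, ?_⟩
  rw [hgh p hp, hl1]
  simp

end Canonical

/-! ### Analytic tools: closed forms, inverse functions, functions of w, linear equations. -/

/-- A function with prescribed derivatives `a i` along a frame `b i` exists on an open convex set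
as soon as the compatibility conditions given by the brackets of the frame hold. -/
theorem exists_primitive_of_frame {B : Set E3} (hB : IsOpen B) (hconv : Convex ℝ B)
    {b : Fin 3 → E3 → E3} (hb : ∀ i, ContDiffOn ℝ ∞ (b i) B)
    (hli : ∀ p ∈ B, LinearIndependent ℝ (fun i => b i p))
    {a : Fin 3 → E3 → ℝ} (ha : ∀ i, ContDiffOn ℝ ∞ (a i) B)
    (hc : ∀ p ∈ B, ∀ i j, i < j → ∃ c : Fin 3 → ℝ, lieBracket ℝ (b i) (b j) p = ∑ k, c k • b k p ∧
      fderiv ℝ (a j) p (b i p) - fderiv ℝ (a i) p (b j p) = ∑ k, c k * a k p) :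
    ∃ Φ : E3 → ℝ, ContDiffOn ℝ ∞ Φ B ∧ ∀ p ∈ B, ∀ i, fderiv ℝ Φ p (b i p) = a i p := by
  set A : E3 → (Fin 3 → ℝ) →L[ℝ] ℝ := fun p =>
    ∑ i, a i p • ContinuousLinearMap.proj (R := ℝ) (φ := fun _ : Fin 3 => ℝ) i with hA
  have hAs : ContDiffOn ℝ ∞ A B := ContDiffOn.sum fun i _ => (ha i).smul contDiffOn_const
  -- `θ` is the 1-form with values `a i` on the frame `b i`.
  set θ : E3 → E3 →L[ℝ] ℝ := fun p => (A p).comp (frameMap (fun i => b i p)).inverse with hθ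
  have hθs : ContDiffOn ℝ ∞ θ B := hAs.clm_comp (contDiffOn_frameMap_inverse hb hli)
  have hθv : ∀ p ∈ B, ∀ c : Fin 3 → ℝ, θ p (∑ k, c k • b k p) = ∑ k, c k * a k p := by
    intro p hp c
    have h1 : (frameMap (fun i => b i p)).inverse (∑ k, c k • b k p) = c := by
      rw [frameMap_inverse_apply (hli p hp), coords_unique (hli p hp)]
    simp only [hθ, hA, ContinuousLinearMap.comp_apply, h1]
    simp [mul_comm]
  have hθb : ∀ p ∈ B, ∀ i, θ p (b i p) = a i p := by
    intro p hp i
    have := hθv p hp (Pi.single i 1)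
    simpa [Pi.single_apply] using this
  have hd : ∀ p ∈ B, ∀ i j, fderiv ℝ θ p (b i p) (b j p) + θ p (fderiv ℝ (b j) p (b i p)) =
      fderiv ℝ (a j) p (b i p) := by
    intro p hp i j
    have e : a j =ᶠ[𝓝 p] fun q => θ q (b j q) :=
      eventually_of_mem (hB.mem_nhds hp) fun q hq => (hθb q hq j).symm
    rw [e.fderiv_eq, fderiv_clm_apply (differentiableAt_of_mem hB hθs hp)
      (differentiableAt_of_mem hB (hb j) hp)]
    simp [add_comm]
  -- This is dθ(X,Y) = X θ(Y) - Y θ(X) - θ([X,Y]) on frame fields: the compatibility conditions say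
  -- that dθ = 0.
  have hsymm_lt : ∀ p ∈ B, ∀ i j, i < j →
      fderiv ℝ θ p (b i p) (b j p) = fderiv ℝ θ p (b j p) (b i p) := by
    intro p hp i j hij
    obtain ⟨c, h1, h2⟩ := hc p hp i j hij
    have h3 := congrArg (θ p) h1
    rw [hθv p hp, lieBracket, map_sub, ← h2] at h3
    linarith [hd p hp i j, hd p hp j i]
  have hsymm : ∀ p ∈ B, ∀ i j,
      fderiv ℝ θ p (b i p) (b j p) = fderiv ℝ θ p (b j p) (b i p) := by
    intro p hp i j
    rcases lt_trichotomy i j with h | h | h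
    · exact hsymm_lt p hp i j h
    · rw [h]
    · exact (hsymm_lt p hp j i h).symm
  -- Poincaré lemma on the convex set `B`.
  obtain ⟨Φ, hΦ⟩ := hconv.exists_forall_hasFDerivAt_of_fderiv_symmetric hB
    (hθs.differentiableOn (by simp)) (by
      intro p hp x y
      rw [← sum_coords (by simp) (hli p hp) x, ← sum_coords (by simp) (hli p hp) y]
      simp only [Fin.sum_univ_three, map_add, map_smul, add_apply, smul_apply, smul_eq_mul]
      rw [hsymm p hp 1 0, hsymm p hp 2 0, hsymm p hp 2 1]
      ring)
  refine ⟨Φ, ?_, fun p hp i => by rw [(hΦ p hp).fderiv, hθb p hp]⟩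
  rw [contDiffOn_infty_iff_fderiv_of_isOpen hB]
  exact ⟨fun p hp => (hΦ p hp).differentiableAt.differentiableWithinAt,
    hθs.congr fun p hp => (hΦ p hp).fderiv⟩

/-- The inverse function theorem, for smooth maps on `ℝ³`. -/
theorem exists_localDiffeo {U : Set E3} (hU : IsOpen U) {Φ : E3 → E3} (hΦ : ContDiffOn ℝ ∞ Φ U)
    {p : E3} (hp : p ∈ U) (hinv : (fderiv ℝ Φ p).IsInvertible) :
    ∃ φ : LocalDiffeo E3, p ∈ φ.source ∧ φ.source ⊆ U ∧ (φ : E3 → E3) = Φ := by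
  obtain ⟨e, he⟩ := hinv
  have hc := hΦ.contDiffAt (hU.mem_nhds hp)
  have hfd : HasFDerivAt Φ (e : E3 →L[ℝ] E3) p := by
    rw [he]; exact (differentiableAt_of_mem hU hΦ hp).hasFDerivAt
  set R := hc.toOpenPartialHomeomorph Φ hfd (by simp) with hR
  have hcf : ContinuousOn (fderiv ℝ Φ) U := hΦ.continuousOn_fderiv_of_isOpen hU (by simp)
  -- The source is shrunk to points with invertible differential, so that the inverse is smooth on
  -- the whole target.
  have hV : IsOpen (U ∩ fderiv ℝ Φ ⁻¹' (range ((↑) : (E3 ≃L[ℝ] E3) → E3 →L[ℝ] E3))) :=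
    hcf.isOpen_inter_preimage hU ContinuousLinearEquiv.isOpen
  set V := U ∩ fderiv ℝ Φ ⁻¹' (range ((↑) : (E3 ≃L[ℝ] E3) → E3 →L[ℝ] E3)) with hVdef
  set R' := R.restrOpen V hV with hR'
  have hsrc : R'.source = R.source ∩ V := R.restrOpen_source V hV
  have hRΦ : (R' : E3 → E3) = Φ := rfl
  refine ⟨⟨R'.toPartialEquiv, R'.open_source, R'.open_target, ?_, ?_⟩, ?_, ?_, hRΦ⟩
  · refine contMDiffOn_iff_contDiffOn.2 (hΦ.mono ?_)
    exact fun q hq => (hsrc ▸ hq : q ∈ R.source ∩ V).2.1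
  · refine contMDiffOn_iff_contDiffOn.2 fun q hq => ?_
    have hq' : R'.symm q ∈ R.source ∩ V := hsrc ▸ R'.map_target hq
    obtain ⟨e', he'⟩ := hq'.2.2
    refine (R'.contDiffAt_symm hq (f₀' := e') ?_ ?_).contDiffWithinAt
    · rw [he', hRΦ]
      exact (differentiableAt_of_mem hU hΦ hq'.2.1).hasFDerivAt
    · exact hΦ.contDiffAt (hU.mem_nhds hq'.2.1)
  · change p ∈ R'.source
    rw [hsrc]
    exact ⟨hc.mem_toOpenPartialHomeomorph_source hfd (by simp), hp, e, he⟩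
  · exact fun q hq => (hsrc ▸ hq : q ∈ R.source ∩ V).2.1

theorem isInvertible_of_linearIndependent {T : E3 →L[ℝ] E3} {u v w : E3}
    (h : LinearIndependent ℝ ![T u, T v, T w]) : T.IsInvertible := by
  have hspan : Submodule.span ℝ (range ![T u, T v, T w]) = ⊤ :=
    h.span_eq_top_of_card_eq_finrank' (by simp)
  have hsurj : Function.Surjective T.toLinearMap := by
    rw [← LinearMap.range_eq_top, eq_top_iff, ← hspan, Submodule.span_le]
    rintro _ ⟨i, rfl⟩
    fin_cases i
    exacts [⟨u, rfl⟩, ⟨v, rfl⟩, ⟨w, rfl⟩]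
  refine ⟨(LinearEquiv.ofBijective T.toLinearMap
    ⟨LinearMap.injective_iff_surjective.2 hsurj, hsurj⟩).toContinuousLinearEquiv, ?_⟩
  ext x
  rfl

/-- A function whose differential vanishes on the kernel of `dw` is locally a function of `w`. -/
theorem exists_eq_comp_of_ker_le {U : Set E3} (hU : IsOpen U) {w ν : E3 → ℝ}
    (hw : ContDiffOn ℝ ∞ w U) (hν : ContDiffOn ℝ ∞ ν U) {p : E3} (hp : p ∈ U)
    (hwp : fderiv ℝ w p ≠ 0)
    (hker : ∀ q ∈ U, ∀ v, fderiv ℝ w q v = 0 → fderiv ℝ ν q v = 0) :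
    ∃ r > 0, ∃ N : ℝ → ℝ, ContDiffOn ℝ ∞ N (Ioo (w p - r) (w p + r)) ∧
      ∀ᶠ q in 𝓝 p, ν q = N (w q) := by
  obtain ⟨v, hv⟩ : ∃ v, fderiv ℝ w p v = 1 := by
    obtain ⟨u, hu⟩ : ∃ u, fderiv ℝ w p u ≠ 0 := by
      by_contra! h
      exact hwp (ContinuousLinearMap.ext h)
    exact ⟨(fderiv ℝ w p u)⁻¹ • u, by simp [hu]⟩
  set ℓ := fderiv ℝ w p with hℓ
  -- `Ψ` straightens the level sets of `w`: its differential at `p` is the identity, and `w` is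
  -- exactly affine in `Ψ`, with linear part `ℓ`.
  set Ψ : E3 → E3 := fun q => q + (w q - w p - ℓ (q - p)) • v with hΨ
  have hΨs : ContDiffOn ℝ ∞ Ψ U :=
    contDiffOn_id.add (((hw.sub contDiffOn_const).sub
      (ℓ.contDiff.comp (contDiff_id.sub contDiff_const)).contDiffOn).smul contDiffOn_const)
  have hΨp : Ψ p = p := by simp [hΨ]
  have hwΨ : ∀ q, w q = w p + ℓ (Ψ q - p) := by
    intro q
    have : Ψ q - p = (q - p) + (w q - w p - ℓ (q - p)) • v := by simp only [hΨ]; abel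
    rw [this, map_add, map_smul, hv]
    simp
  have hdΨ : fderiv ℝ Ψ p = ContinuousLinearMap.id ℝ E3 := by
    have hdw := (differentiableAt_of_mem hU hw hp).hasFDerivAt
    have h1 : HasFDerivAt (fun q => w q - w p - ℓ (q - p)) (ℓ - ℓ.comp (.id ℝ E3)) p :=
      (hdw.sub_const _).sub (ℓ.hasFDerivAt.comp p ((hasFDerivAt_id p).sub_const p))
    have h2 : HasFDerivAt Ψ (.id ℝ E3 + (ℓ - ℓ.comp (.id ℝ E3)).smulRight v) p :=
      (hasFDerivAt_id p).add (h1.smul_const v)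
    rw [h2.fderiv]
    ext x
    simp
  obtain ⟨ψ, hpψ, hψU, hψ⟩ := exists_localDiffeo hU hΨs hp ⟨.refl ℝ E3, by rw [hdΨ]; rfl⟩
  have hpt : p ∈ ψ.target := by
    have := ψ.map_source hpψ
    rwa [hψ, hΨp] at this
  obtain ⟨δ, hδ, hball⟩ := Metric.isOpen_iff.1 ψ.open_target p hpt
  set s : E3 → E3 := ψ.invFun with hs
  have hss : ContDiffOn ℝ ∞ s ψ.target := contMDiffOn_iff_contDiffOn.1 ψ.contMDiffOn_invFun
  have hsU : ∀ q ∈ ψ.target, s q ∈ U := fun q hq => hψU (ψ.map_target hq)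
  have hΨs' : ∀ q ∈ ψ.target, Ψ (s q) = q := fun q hq => by
    have := ψ.right_inv hq
    rwa [hψ] at this
  have hsw : ∀ q ∈ ψ.target, w (s q) = w p + ℓ (q - p) := fun q hq => by
    rw [hwΨ (s q), hΨs' q hq]
  have hνs : ContDiffOn ℝ ∞ (ν ∘ s) ψ.target := hν.comp hss hsU
  have hkerν : ∀ q ∈ ψ.target, ∀ x, ℓ x = 0 → fderiv ℝ (ν ∘ s) q x = 0 := by
    intro q hq x hx
    have ds := differentiableAt_of_mem ψ.open_target hss hq
    have h1 : fderiv ℝ (w ∘ s) q x = 0 := by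
      have e : w ∘ s =ᶠ[𝓝 q] fun y => w p + ℓ (y - p) :=
        eventually_of_mem (ψ.open_target.mem_nhds hq) hsw
      have : HasFDerivAt (fun y => w p + ℓ (y - p)) (ℓ.comp (.id ℝ E3)) q :=
        (ℓ.hasFDerivAt.comp q ((hasFDerivAt_id q).sub_const p)).const_add _
      rw [e.fderiv_eq, this.fderiv]
      exact hx
    rw [fderiv_comp q (differentiableAt_of_mem hU hw (hsU q hq)) ds] at h1
    rw [fderiv_comp q (differentiableAt_of_mem hU hν (hsU q hq)) ds]
    exact hker _ (hsU q hq) _ h1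
  have hv0 : v ≠ 0 := by rintro rfl; simp at hv
  have hvn : 0 < ‖v‖ := norm_pos_iff.2 hv0
  -- A line through `p` transverse to the flattened level sets, parametrised by the value of `w`;
  -- `N` will be `ν ∘ s` along it.
  set c : ℝ → E3 := fun t => p + (t - w p) • v with hcdef
  have hcs : ContDiff ℝ ∞ c := contDiff_const.add ((contDiff_id.sub contDiff_const).smul contDiff_const)
  have hcb : ∀ t, |t - w p| < δ / ‖v‖ → c t ∈ Metric.ball p δ := by
    intro t ht
    rw [Metric.mem_ball, dist_eq_norm]
    simp only [hcdef, add_sub_cancel_left, norm_smul, Real.norm_eq_abs]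
    exact (lt_div_iff₀ hvn).1 ht
  refine ⟨δ / ‖v‖, by positivity, fun t => ν (s (c t)), ?_, ?_⟩
  · refine hνs.comp hcs.contDiffOn fun t ht => hball (hcb t ?_)
    rw [abs_lt]
    constructor <;> linarith [ht.1, ht.2]
  · have hcw := (hw.continuousOn.continuousAt (hU.mem_nhds hp))
    have hcΨ := (hΨs.continuousOn.continuousAt (hU.mem_nhds hp))
    have e1 : ∀ᶠ q in 𝓝 p, Ψ q ∈ Metric.ball p δ :=
      hcΨ.eventually (by rw [hΨp]; exact Metric.ball_mem_nhds p hδ)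
    have e2 : ∀ᶠ q in 𝓝 p, w q ∈ Metric.ball (w p) (δ / ‖v‖) :=
      hcw.eventually (Metric.ball_mem_nhds _ (by positivity))
    filter_upwards [e1, e2, ψ.open_source.mem_nhds hpψ] with q h1 h2 h3
    have hq : s (Ψ q) = q := by
      have := ψ.left_inv h3
      rwa [hψ] at this
    have h4 := hcb (w q) h2
    set x := Ψ q
    set y := c (w q)
    have hxy : ℓ (x - y) = 0 := by
      have h5 : x - y = (x - p) - (w q - w p) • v := by simp only [y, hcdef]; abel
      rw [h5, map_sub, map_smul, hv, hwΨ q]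
      simp [x]
    suffices (ν ∘ s) x = (ν ∘ s) y by
      simpa [hq] using this
    -- The points `x` and `y` lie in the same flattened level set, and `ν ∘ s` has zero derivative
    -- along the segment joining them.
    set L : ℝ → ℝ := fun t => (ν ∘ s) (y + t • (x - y)) with hL
    have hseg : ∀ t ∈ Icc (0 : ℝ) 1, y + t • (x - y) ∈ ψ.target := fun t ht =>
      hball ((convex_ball p δ).add_smul_sub_mem h4 h1 ht)
    have hLd : ∀ t ∈ Icc (0 : ℝ) 1, HasDerivAt L 0 t := by
      intro t ht
      have ht' := hseg t ht
      have hd1 := (differentiableAt_of_mem ψ.open_target hνs ht').hasFDerivAt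
      have hd2 : HasDerivAt (fun t : ℝ => y + t • (x - y)) ((1 : ℝ) • (x - y)) t :=
        ((hasDerivAt_id t).smul_const (x - y)).const_add y
      have hd3 := hd1.comp_hasDerivAt t hd2
      rw [one_smul, hkerν _ ht' _ hxy] at hd3
      exact hd3
    have := constant_of_has_deriv_right_zero (f := L) (a := 0) (b := 1)
      (fun t ht => (hLd t ht).continuousAt.continuousWithinAt)
      (fun t ht => (hLd t (Ico_subset_Icc_self ht)).hasDerivWithinAt) 1 (by simp)
    simpa [hL] using this

/-- Local solutions of the linear equation `F'' = ε F + N F'`. -/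
theorem exists_linear_ode_solution {N : ℝ → ℝ} {ε t₀ r : ℝ} (hr : 0 < r)
    (hN : ContDiffOn ℝ ∞ N (Ioo (t₀ - r) (t₀ + r))) (c d : ℝ) :
    ∃ r' > 0, r' ≤ r ∧ ∃ F F' : ℝ → ℝ,
      ContDiffOn ℝ ∞ F (Ioo (t₀ - r') (t₀ + r')) ∧ ContDiffOn ℝ ∞ F' (Ioo (t₀ - r') (t₀ + r')) ∧
      (∀ t ∈ Ioo (t₀ - r') (t₀ + r'), HasDerivAt F (F' t) t ∧
        HasDerivAt F' (ε * F t + N t * F' t) t) ∧ F t₀ = c ∧ F' t₀ = d := by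
  -- The equation becomes autonomous once time is added as a third unknown; `h4` below shows that
  -- this unknown is indeed t.
  set X : ℝ × ℝ × ℝ → ℝ × ℝ × ℝ := fun z => (z.2.1, ε * z.1 + N z.2.2 * z.2.1, 1) with hX
  have ht₀ : Ioo (t₀ - r) (t₀ + r) ∈ 𝓝 t₀ := Ioo_mem_nhds (by linarith) (by linarith)
  have hXs : ContDiffAt ℝ 1 X (c, d, t₀) := by
    have hN1 : ContDiffAt ℝ 1 N ((c, d, t₀) : ℝ × ℝ × ℝ).2.2 :=
      (hN.contDiffAt ht₀).of_le (by simp)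
    have : ContDiffAt ℝ 1 (fun z : ℝ × ℝ × ℝ => N z.2.2) (c, d, t₀) :=
      hN1.comp (c, d, t₀) (by fun_prop)
    fun_prop
  obtain ⟨z, hz0, ρ, hρ, hz⟩ :=
    hXs.exists_forall_mem_closedBall_exists_eq_forall_mem_Ioo_hasDerivAt₀ t₀
  set I := Ioo (t₀ - min ρ r) (t₀ + min ρ r) with hI
  have hIρ : I ⊆ Ioo (t₀ - ρ) (t₀ + ρ) :=
    Ioo_subset_Ioo (by linarith [min_le_left ρ r]) (by linarith [min_le_left ρ r])
  have hIr : I ⊆ Ioo (t₀ - r) (t₀ + r) :=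
    Ioo_subset_Ioo (by linarith [min_le_right ρ r]) (by linarith [min_le_right ρ r])
  have hr' : 0 < min ρ r := lt_min hρ hr
  have ht₀I : t₀ ∈ I := ⟨by linarith, by linarith⟩
  have h1 : ∀ t ∈ I, HasDerivAt (fun t => (z t).1) (z t).2.1 t := fun t ht => (hz t (hIρ ht)).fst
  have h2 : ∀ t ∈ I, HasDerivAt (fun t => (z t).2.1) (ε * (z t).1 + N (z t).2.2 * (z t).2.1) t :=
    fun t ht => (hz t (hIρ ht)).snd.fst
  have h3 : ∀ t ∈ I, HasDerivAt (fun t => (z t).2.2 - t) 0 t := fun t ht => by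
    have h : HasDerivAt (fun t => (z t).2.2) 1 t := (hz t (hIρ ht)).snd.snd
    simpa using h.fun_sub (hasDerivAt_id' t)
  have h4 : ∀ t ∈ I, (z t).2.2 = t := fun t ht => by
    have := isOpen_Ioo.is_const_of_deriv_eq_zero isPreconnected_Ioo
      (fun s hs => (h3 s hs).differentiableAt.differentiableWithinAt)
      (fun s hs => (h3 s hs).deriv) ht ht₀I
    rw [hz0] at this
    linarith
  have h2' : ∀ t ∈ I, HasDerivAt (fun t => (z t).2.1) (ε * (z t).1 + N t * (z t).2.1) t :=
    fun t ht => by simpa only [h4 t ht] using h2 t ht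
  have hN' : ContDiffOn ℝ ∞ N I := hN.mono hIr
  -- Picard–Lindelöf gives only differentiable solutions; the equation itself raises their
  -- regularity one order at a time.
  have hs : ∀ n : ℕ, ContDiffOn ℝ n (fun t => (z t).1) I ∧ ContDiffOn ℝ n (fun t => (z t).2.1) I := by
    intro n
    induction n with
    | zero =>
      exact ⟨contDiffOn_zero.2 fun t ht => (h1 t ht).continuousAt.continuousWithinAt,
        contDiffOn_zero.2 fun t ht => (h2' t ht).continuousAt.continuousWithinAt⟩
    | succ n ih =>
      have hNn : ContDiffOn ℝ n N I := hN'.of_le (by exact_mod_cast le_top)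
      push_cast
      rw [contDiffOn_succ_iff_deriv_of_isOpen isOpen_Ioo,
        contDiffOn_succ_iff_deriv_of_isOpen isOpen_Ioo]
      refine ⟨⟨fun t ht => (h1 t ht).differentiableAt.differentiableWithinAt, by simp,
        ih.2.congr fun t ht => (h1 t ht).deriv⟩,
        fun t ht => (h2' t ht).differentiableAt.differentiableWithinAt, by simp,
        ((contDiffOn_const.mul ih.1).add (hNn.mul ih.2)).congr fun t ht => (h2' t ht).deriv⟩
  exact ⟨min ρ r, hr', min_le_right _ _, fun t => (z t).1, fun t => (z t).2.1,
    contDiffOn_infty.2 fun n => (hs n).1, contDiffOn_infty.2 fun n => (hs n).2,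
    fun t ht => ⟨h1 t ht, h2' t ht⟩, by simp [hz0], by simp [hz0]⟩

/-! ### Calculus in the coordinates (x, y, w). -/

section Coordinates

theorem hasFDerivAt_coord (i : Fin 3) (q : E3) :
    HasFDerivAt (fun q : E3 => q i) (EuclideanSpace.proj (𝕜 := ℝ) i : E3 →L[ℝ] ℝ) q :=
  (EuclideanSpace.proj (𝕜 := ℝ) i : E3 →L[ℝ] ℝ).hasFDerivAt

theorem contDiffOn_vec3 {U : Set E3} {a b c : E3 → ℝ} (ha : ContDiffOn ℝ ∞ a U)
    (hb : ContDiffOn ℝ ∞ b U) (hc : ContDiffOn ℝ ∞ c U) :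
    ContDiffOn ℝ ∞ (fun q => (!₂[a q, b q, c q] : E3)) U := by
  rw [contDiffOn_euclidean]
  intro i
  fin_cases i
  exacts [ha, hb, hc]

theorem fderiv_vec3 {a b c : E3 → ℝ} {q : E3} (ha : DifferentiableAt ℝ a q)
    (hb : DifferentiableAt ℝ b q) (hc : DifferentiableAt ℝ c q) (v : E3) :
    fderiv ℝ (fun q => (!₂[a q, b q, c q] : E3)) q v =
      !₂[fderiv ℝ a q v, fderiv ℝ b q v, fderiv ℝ c q v] := by
  have hd : DifferentiableAt ℝ (fun q => (!₂[a q, b q, c q] : E3)) q := by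
    rw [differentiableAt_euclidean]
    intro i
    fin_cases i
    exacts [ha, hb, hc]
  have h := fun i : Fin 3 => (hasFDerivAt_coord i _).comp q hd.hasFDerivAt
  ext i
  have hi := congrArg (fun T => T v) (h i).fderiv
  fin_cases i
  exacts [hi.symm, hi.symm, hi.symm]

theorem contDiff_coord (i : Fin 3) : ContDiff ℝ ∞ (fun q : E3 => q i) :=
  (EuclideanSpace.proj (𝕜 := ℝ) i : E3 →L[ℝ] ℝ).contDiff

theorem hasFDerivAt_comp_coord {F : ℝ → ℝ} {F' : ℝ} {q : E3} (hF : HasDerivAt F F' (q 2)) :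
    HasFDerivAt (fun q : E3 => F (q 2)) (F' • (EuclideanSpace.proj (𝕜 := ℝ) 2 : E3 →L[ℝ] ℝ)) q :=
  hF.comp_hasFDerivAt q (hasFDerivAt_coord 2 q)

theorem vec3_combination (a b c : ℝ) (u v w : Fin 3 → ℝ) :
    a • (!₂[u 0, u 1, u 2] : E3) + b • !₂[v 0, v 1, v 2] + c • !₂[w 0, w 1, w 2] =
      !₂[a * u 0 + b * v 0 + c * w 0, a * u 1 + b * v 1 + c * w 1, a * u 2 + b * v 2 + c * w 2] := by
  ext i
  fin_cases i <;> simp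

theorem vec3_eq_iff {a b c a' b' c' : ℝ} :
    (!₂[a, b, c] : E3) = !₂[a', b', c'] ↔ a = a' ∧ b = b' ∧ c = c' := by
  constructor
  · intro h
    exact ⟨by simpa using congrArg (fun v : E3 => v 0) h,
      by simpa using congrArg (fun v : E3 => v 1) h, by simpa using congrArg (fun v : E3 => v 2) h⟩
  · rintro ⟨rfl, rfl, rfl⟩
    rfl

theorem vec3_zero : (0 : E3) = !₂[0, 0, 0] := by
  ext i
  fin_cases i <;> simp

end Coordinates

/-! ### Structure functions of the systems (T). -/

section TrivialSystems

variable {S : Set ℝ} (hS : IsOpen S) {F₁ F₂ : ℝ → ℝ} (h₁ : ContDiffOn ℝ ∞ F₁ S)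
  (h₂ : ContDiffOn ℝ ∞ F₂ S)

theorem contDiffOn_trivF (h₁ : ContDiffOn ℝ ∞ F₁ S) (h₂ : ContDiffOn ℝ ∞ F₂ S) :
    ContDiffOn ℝ ∞ (trivF F₁ F₂ : E3 → E3) {p | p 2 ∈ S} :=
  contDiffOn_vec3 (h₁.comp (contDiff_coord 2).contDiffOn fun _ h => h)
    (h₂.comp (contDiff_coord 2).contDiffOn fun _ h => h) contDiffOn_const

theorem contDiff_trivG : ContDiff ℝ ∞ (trivG : E3 → E3) := contDiff_const

theorem fderiv_trivF {p : E3} (h₁ : DifferentiableAt ℝ F₁ (p 2)) (h₂ : DifferentiableAt ℝ F₂ (p 2))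
    (v : E3) : fderiv ℝ (trivF F₁ F₂ : E3 → E3) p v =
      !₂[deriv F₁ (p 2) * v 2, deriv F₂ (p 2) * v 2, 0] := by
  have d₁ := hasFDerivAt_comp_coord h₁.hasDerivAt
  have d₂ := hasFDerivAt_comp_coord h₂.hasDerivAt
  refine (fderiv_vec3 d₁.differentiableAt d₂.differentiableAt (differentiableAt_const 0) v).trans ?_
  rw [d₁.fderiv, d₂.fderiv]
  simp

theorem lieBracket_trivG_trivF {p : E3} (h₁ : DifferentiableAt ℝ F₁ (p 2))
    (h₂ : DifferentiableAt ℝ F₂ (p 2)) :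
    lieBracket ℝ (trivG : E3 → E3) (trivF F₁ F₂) p = (trivF (deriv F₁) (deriv F₂) p : E3) := by
  have hG : fderiv ℝ (trivG : E3 → E3) p = 0 := (hasFDerivAt_const _ p).fderiv
  change fderiv ℝ (trivF F₁ F₂ : E3 → E3) p (trivG p) - fderiv ℝ (trivG : E3 → E3) p _ = _
  refine (congrArg₂ (fun u v : E3 => u - v) (fderiv_trivF h₁ h₂ _)
    (congrArg (fun T : E3 →L[ℝ] E3 => T (trivF F₁ F₂ p)) hG)).trans ?_
  simp [trivG, trivF]

include hS h₁ h₂ in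
/-- The structure functions of a regular trivial system. -/
theorem trivial_structure {T : Set E3} (hT : ∀ p ∈ T, p 2 ∈ S)
    (hreg : RegularOn (trivF F₁ F₂) trivG T) :
    ∀ p ∈ T, wronsk F₁ F₂ (p 2) ≠ 0 ∧
      (∀ i, kFun (trivF F₁ F₂) trivG i p = 0) ∧
      lamFun (trivF F₁ F₂) trivG 0 p =
        -(wronsk (deriv F₁) (deriv F₂) (p 2) / wronsk F₁ F₂ (p 2)) ∧
      lamFun (trivF F₁ F₂) trivG 1 p = 0 ∧
      lamFun (trivF F₁ F₂) trivG 2 p = deriv (wronsk F₁ F₂) (p 2) / wronsk F₁ F₂ (p 2) := by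
  intro p hp
  have hpS := hT p hp
  have hS' : IsOpen {p : E3 | p 2 ∈ S} := hS.preimage (contDiff_coord 2).continuous
  have d : ∀ {F : ℝ → ℝ}, ContDiffOn ℝ ∞ F S → ∀ t ∈ S, DifferentiableAt ℝ F t :=
    fun h t ht => (h.contDiffAt (hS.mem_nhds ht)).differentiableAt (by simp)
  have h₁' : ContDiffOn ℝ ∞ (deriv F₁) S := ((contDiffOn_infty_iff_deriv_of_isOpen hS).1 h₁).2
  have h₂' : ContDiffOn ℝ ∞ (deriv F₂) S := ((contDiffOn_infty_iff_deriv_of_isOpen hS).1 h₂).2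
  have eh : ∀ q : E3, q 2 ∈ S → lieBracket ℝ (trivG : E3 → E3) (trivF F₁ F₂) q =
      (trivF (deriv F₁) (deriv F₂) q : E3) := fun q hq =>
    lieBracket_trivG_trivF (d h₁ _ hq) (d h₂ _ hq)
  have e : lieBracket ℝ (trivG : E3 → E3) (trivF F₁ F₂) =ᶠ[𝓝 p]
      (trivF (deriv F₁) (deriv F₂) : E3 → E3) := eventually_of_mem (hS'.mem_nhds hpS) eh
  have hK : lieBracket ℝ (trivG : E3 → E3) (lieBracket ℝ (trivG : E3 → E3) (trivF F₁ F₂)) p =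
      (trivF (deriv (deriv F₁)) (deriv (deriv F₂)) p : E3) :=
    (EventuallyEq.rfl.lieBracket_vectorField_eq e).trans
      (lieBracket_trivG_trivF (d h₁' _ hpS) (d h₂' _ hpS))
  have hJ : lieBracket ℝ (trivF F₁ F₂ : E3 → E3) (lieBracket ℝ (trivG : E3 → E3) (trivF F₁ F₂)) p =
      0 := by
    refine (EventuallyEq.rfl.lieBracket_vectorField_eq e).trans ?_
    change fderiv ℝ (trivF (deriv F₁) (deriv F₂) : E3 → E3) p (trivF F₁ F₂ p) -
      fderiv ℝ (trivF F₁ F₂ : E3 → E3) p (trivF (deriv F₁) (deriv F₂) p) = 0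
    refine (congrArg₂ (fun u v : E3 => u - v) (fderiv_trivF (d h₁' _ hpS) (d h₂' _ hpS) _)
      (fderiv_trivF (d h₁ _ hpS) (d h₂ _ hpS) _)).trans ?_
    simp [trivF]
  obtain ⟨hA, hB⟩ := (regularOn_iff _ _ _).1 hreg p hp
  have hA' := linearIndependent_triple.1 hA
  rw [eh p hpS] at hA'
  -- If W = 0, then (F₁', -F₁) and (F₂', -F₂) are coefficients of linear relations between f and
  -- [g,f]. Independence makes all four numbers vanish, so f itself would be zero.
  have hW : wronsk F₁ F₂ (p 2) ≠ 0 := by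
    intro hW
    unfold wronsk at hW
    have r : ∀ a c : ℝ, a * F₁ (p 2) + c * deriv F₁ (p 2) = 0 →
        a * F₂ (p 2) + c * deriv F₂ (p 2) = 0 → a = 0 ∧ c = 0 := by
      intro a c k₁ k₂
      have := hA' a 0 c (by
        rw [vec3_zero]
        refine (vec3_combination a 0 c ![F₁ (p 2), F₂ (p 2), 0] ![0, 0, 1]
          ![deriv F₁ (p 2), deriv F₂ (p 2), 0]).trans ?_
        rw [vec3_eq_iff]
        simpa using ⟨k₁, k₂⟩)
      exact ⟨this.1, this.2.2⟩
    obtain ⟨r1, r2⟩ := r (deriv F₁ (p 2)) (-F₁ (p 2)) (by ring) (by linarith)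
    obtain ⟨r3, r4⟩ := r (deriv F₂ (p 2)) (-F₂ (p 2)) (by linarith) (by ring)
    have := r 1 0 (by linarith) (by linarith)
    norm_num at this
  have hdW : deriv (wronsk F₁ F₂) (p 2) =
      deriv (deriv F₁) (p 2) * F₂ (p 2) - F₁ (p 2) * deriv (deriv F₂) (p 2) := by
    have := ((d h₁' _ hpS).hasDerivAt.mul (d h₂ _ hpS).hasDerivAt).sub
      ((d h₁ _ hpS).hasDerivAt.mul (d h₂' _ hpS).hasDerivAt)
    refine Eq.trans this.deriv ?_
    ring
  -- Cramer's rule for (F₁'', F₂'') in terms of (F₁, F₂) and (F₁', F₂').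
  have hl := coords_triple (V := E3) hA (x := lieBracket ℝ (trivG : E3 → E3)
      (lieBracket ℝ (trivG : E3 → E3) (trivF F₁ F₂)) p)
    (a := -(wronsk (deriv F₁) (deriv F₂) (p 2) / wronsk F₁ F₂ (p 2))) (b := 0)
    (c := deriv (wronsk F₁ F₂) (p 2) / wronsk F₁ F₂ (p 2)) (by
      rw [hK, eh p hpS, hdW]
      refine Eq.trans ?_ (vec3_combination _ _ _ ![F₁ (p 2), F₂ (p 2), 0] ![0, 0, 1]
          ![deriv F₁ (p 2), deriv F₂ (p 2), 0]).symm
      refine vec3_eq_iff.2 ⟨?_, ?_, by simp⟩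
      · simp only [Matrix.cons_val]
        field_simp
        simp only [wronsk]
        ring
      · simp only [Matrix.cons_val]
        field_simp
        simp only [wronsk]
        ring)
  have z : ∀ u v w : E3, -(0 : E3) = (0 : ℝ) • u + (0 : ℝ) • v + (0 : ℝ) • w := by simp
  have hk := coords_triple (V := E3) hB (x := -lieBracket ℝ (trivF F₁ F₂ : E3 → E3)
      (lieBracket ℝ (trivG : E3 → E3) (trivF F₁ F₂)) p) (a := 0) (b := 0) (c := 0)
    (by rw [hJ]; exact z _ _ _)
  refine ⟨hW, fun i => ?_, (lamFun_eq _ _ 0 p).trans (congrFun hl 0),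
    (lamFun_eq _ _ 1 p).trans (congrFun hl 1), (lamFun_eq _ _ 2 p).trans (congrFun hl 2)⟩
  refine (kFun_eq _ _ i p).trans ((congrFun hk i).trans ?_)
  fin_cases i <;> rfl

end TrivialSystems

theorem pushesTo_of_fderiv {φ : LocalDiffeo E3} {Φ : E3 → E3} (hφ : (φ : E3 → E3) = Φ)
    {f : E3 → E3} {f' : E3 → E3} (h : ∀ q ∈ φ.source, fderiv ℝ Φ q (f q) = f' (Φ q)) :
    PushesTo (M := E3) φ f f' := by
  intro q hq
  have h1 := h q hq
  rw [← hφ, ← mfderiv_eq_fderiv] at h1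
  exact h1

theorem isOpen_coord_preimage {S : Set ℝ} (hS : IsOpen S) : IsOpen {q : E3 | q 2 ∈ S} :=
  hS.preimage (contDiff_coord 2).continuous

theorem linearIndependent_std {a : ℝ} (ha : a ≠ 0) :
    LinearIndependent ℝ (![!₂[1, 0, 0], !₂[0, a, 0], !₂[0, 0, 1]] : Fin 3 → E3) := by
  rw [linearIndependent_triple]
  intro x y z h
  have := (vec3_combination x y z ![1, 0, 0] ![0, a, 0] ![0, 0, 1]).symm.trans (h.trans vec3_zero)
  have := vec3_eq_iff.1 this
  simpa [ha] using this

/-! ### The change of coordinates between the two canonical forms. -/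

section SecondForm

variable {I : Set ℝ} (hI : IsOpen I) {F₁ F₁' F₂ F₂' N : ℝ → ℝ} {ε : ℝ}

/-- The map carrying the second canonical form to the first one. -/
noncomputable def secToTriv (F₁ F₁' F₂ F₂' : ℝ → ℝ) (q : E3) : E3 :=
  !₂[q 0 * F₁ (q 2) - q 1 * F₁' (q 2), q 0 * F₂ (q 2) - q 1 * F₂' (q 2), q 2]

theorem contDiffOn_secToTriv (h₁ : ContDiffOn ℝ ∞ F₁ I) (h₁' : ContDiffOn ℝ ∞ F₁' I)
    (h₂ : ContDiffOn ℝ ∞ F₂ I) (h₂' : ContDiffOn ℝ ∞ F₂' I) :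
    ContDiffOn ℝ ∞ (secToTriv F₁ F₁' F₂ F₂') {q | q 2 ∈ I} := by
  have c : ∀ {F : ℝ → ℝ}, ContDiffOn ℝ ∞ F I →
      ContDiffOn ℝ ∞ (fun q : E3 => F (q 2)) {q | q 2 ∈ I} := fun h =>
    h.comp (contDiff_coord 2).contDiffOn fun _ h => h
  have d : ∀ i : Fin 3, ContDiffOn ℝ ∞ (fun q : E3 => q i) {q | q 2 ∈ I} := fun i =>
    (contDiff_coord i).contDiffOn
  exact contDiffOn_vec3 (((d 0).mul (c h₁)).sub ((d 1).mul (c h₁')))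
    (((d 0).mul (c h₂)).sub ((d 1).mul (c h₂'))) (d 2)

theorem fderiv_secToTriv {q : E3} {a b : ℝ} (h₁ : HasDerivAt F₁ (F₁' (q 2)) (q 2))
    (h₁' : HasDerivAt F₁' a (q 2)) (h₂ : HasDerivAt F₂ (F₂' (q 2)) (q 2))
    (h₂' : HasDerivAt F₂' b (q 2)) (v : E3) :
    fderiv ℝ (secToTriv F₁ F₁' F₂ F₂') q v =
      !₂[v 0 * F₁ (q 2) + q 0 * F₁' (q 2) * v 2 - v 1 * F₁' (q 2) - q 1 * a * v 2,
        v 0 * F₂ (q 2) + q 0 * F₂' (q 2) * v 2 - v 1 * F₂' (q 2) - q 1 * b * v 2, v 2] := by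
  have key : ∀ {F F' : ℝ → ℝ} {c : ℝ}, HasDerivAt F (F' (q 2)) (q 2) → HasDerivAt F' c (q 2) →
      HasFDerivAt (fun q : E3 => q 0 * F (q 2) - q 1 * F' (q 2)) _ q := fun h h' =>
    ((hasFDerivAt_coord 0 q).mul (hasFDerivAt_comp_coord h)).sub
      ((hasFDerivAt_coord 1 q).mul (hasFDerivAt_comp_coord h'))
  refine (fderiv_vec3 (key h₁ h₁').differentiableAt (key h₂ h₂').differentiableAt
    (hasFDerivAt_coord 2 q).differentiableAt v).trans ?_
  rw [(key h₁ h₁').fderiv, (key h₂ h₂').fderiv, (hasFDerivAt_coord 2 q).fderiv, vec3_eq_iff]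
  refine ⟨?_, ?_, rfl⟩ <;>
  · simp
    ring

end SecondForm

/-! ### Construction of both canonical forms on open subsets of ℝ³. -/

section NormalForms

variable {U : Set E3} (hU : IsOpen U) {f g : E3 → E3}
  (hf : ContDiffOn ℝ ∞ f U) (hg : ContDiffOn ℝ ∞ g U)

include hU hf hg in
/-- The two canonical forms of a canonical pair satisfying the triviality conditions. -/
theorem exists_normal_forms (hcan : IsCanonicalOn (M := E3) f g U)
    (hκ : ∀ p ∈ U, kFun (M := E3) f g 0 p = 0)
    (hν : ∀ p ∈ U, fderiv ℝ (lamFun (M := E3) f g 2) p (f p) = 0)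
    (hν' : ∀ p ∈ U, fderiv ℝ (lamFun (M := E3) f g 2) p (lieBracket ℝ g f p) = 0)
    {p : E3} (hp : p ∈ U) :
    ∃ ε : ℝ, (ε = 1 ∨ ε = -1) ∧
      (∃ (φ : LocalDiffeo E3) (F₁ F₂ : ℝ → ℝ), p ∈ φ.source ∧ φ.source ⊆ U ∧
        ContDiffOn ℝ ∞ F₁ (wRange φ) ∧ ContDiffOn ℝ ∞ F₂ (wRange φ) ∧
        PushesTo φ f (trivF F₁ F₂) ∧ PushesTo φ g trivG ∧
        ∀ q ∈ φ.source, lamFun (M := E3) f g 0 q = ε) ∧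
      ∃ (φ : LocalDiffeo E3) (N : ℝ → ℝ), p ∈ φ.source ∧ φ.source ⊆ U ∧
        ContDiffOn ℝ ∞ N (wRange φ) ∧
        PushesTo φ f secF ∧ PushesTo φ g (secG ε N) ∧
        ∀ q ∈ φ.source, lamFun (M := E3) f g 0 q = ε ∧
          lamFun (M := E3) f g 2 q = N (φ q 2) := by
  set ν := lamFun (M := E3) f g 2
  set ε := lamFun (M := E3) f g 0 p with hε
  have hbr := brackets_of_canonical hU hf hg hcan hκ hν
  have sl : ∀ i, ContDiffOn ℝ ∞ (lamFun (M := E3) f g i) U := contDiffOn_lamFun hU hf hg hcan.1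
  refine ⟨ε, (hcan.2 p hp).2, ?_⟩
  set h := lieBracket ℝ g f with hh
  have hhs : ContDiffOn ℝ ∞ h U := contDiffOn_lieBracket hU hg hf
  have hfg : ∀ q, lieBracket ℝ f g q = -h q := fun q => lieBracket_swap
  -- A ball inside `U` on which λ₁ keeps its value ε at `p`.
  obtain ⟨ρ, hρ, hball⟩ := Metric.eventually_nhds_iff_ball.1
    ((eventually_eq_of_eq_one_or hU (sl 0).continuousOn (fun q hq => (hcan.2 q hq).2) hp).and
      (hU.mem_nhds hp))
  have hBU : ∀ {r : ℝ}, r ≤ ρ → Metric.ball p r ⊆ U := fun hr q hq =>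
    (hball q (Metric.ball_subset_ball hr hq)).2
  have hgh : ∀ q ∈ Metric.ball p ρ, lieBracket ℝ g h q = ε • f q + ν q • h q := fun q hq => by
    rw [(hbr q (hBU le_rfl hq)).2, (hball q hq).1]
  set b : Fin 3 → E3 → E3 := ![f, g, h] with hb
  have hbs : ∀ i, ContDiffOn ℝ ∞ (b i) U := by
    intro i
    fin_cases i
    exacts [hf, hg, hhs]
  have hbp : ∀ q, (fun i => b i q) = ![f q, g q, h q] := fun q => by
    funext i
    fin_cases i <;> rfl
  have hli : ∀ q ∈ U, LinearIndependent ℝ (fun i => b i q) := fun q hq => by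
    rw [hbp]
    exact ((regularOn_iff f g U).1 hcan.1 q hq).1
  -- primitives of closed forms with prescribed values on the frame
  have prim : ∀ r ≤ ρ, ∀ a₀ a₁ a₂ : E3 → ℝ, ContDiffOn ℝ ∞ a₀ (Metric.ball p r) →
      ContDiffOn ℝ ∞ a₁ (Metric.ball p r) → ContDiffOn ℝ ∞ a₂ (Metric.ball p r) →
      (∀ q ∈ Metric.ball p r, fderiv ℝ a₁ q (f q) - fderiv ℝ a₀ q (g q) = -a₂ q ∧
        fderiv ℝ a₂ q (f q) - fderiv ℝ a₀ q (h q) = 0 ∧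
        fderiv ℝ a₂ q (g q) - fderiv ℝ a₁ q (h q) = ε * a₀ q + ν q * a₂ q) →
      ∃ Φ : E3 → ℝ, ContDiffOn ℝ ∞ Φ (Metric.ball p r) ∧ ∀ q ∈ Metric.ball p r,
        fderiv ℝ Φ q (f q) = a₀ q ∧ fderiv ℝ Φ q (g q) = a₁ q ∧ fderiv ℝ Φ q (h q) = a₂ q := by
    intro r hr a₀ a₁ a₂ h₀ h₁ h₂ hc
    obtain ⟨Φ, hΦ, hΦ'⟩ := exists_primitive_of_frame (B := Metric.ball p r) Metric.isOpen_ball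
      (convex_ball p r) (b := b) (fun i => (hbs i).mono (hBU hr)) (fun q hq => hli q (hBU hr hq))
      (a := ![a₀, a₁, a₂]) (by intro i; fin_cases i; exacts [h₀, h₁, h₂]) (by
        intro q hq i j hij
        obtain ⟨c1, c2, c3⟩ := hc q hq
        fin_cases i <;> fin_cases j <;> first | exact absurd hij (by decide) | skip
        · refine ⟨![0, 0, -1], (hfg q).trans ?_, ?_⟩
          · simp [Fin.sum_univ_three, hb]
          · simpa [Fin.sum_univ_three, hb] using c1
        · refine ⟨0, (hbr q (hBU hr hq)).1.trans ?_, ?_⟩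
          · simp
          · simpa [hb] using c2
        · refine ⟨![ε, 0, ν q], (hgh q (Metric.ball_subset_ball hr hq)).trans ?_, ?_⟩
          · simp [Fin.sum_univ_three, hb]
          · simpa [Fin.sum_univ_three, hb] using c3)
    exact ⟨Φ, hΦ, fun q hq => ⟨hΦ' q hq 0, hΦ' q hq 1, hΦ' q hq 2⟩⟩
  obtain ⟨w, hw, hw'⟩ := prim ρ le_rfl (fun _ => 0) (fun _ => 1) (fun _ => 0) contDiffOn_const
    contDiffOn_const contDiffOn_const (by intro q hq; simp)
  -- `ν` is a function of `w`
  have hBo : IsOpen (Metric.ball p ρ) := Metric.isOpen_ball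
  have hpB : p ∈ Metric.ball p ρ := Metric.mem_ball_self hρ
  obtain ⟨r₀, hr₀, N, hN, hNw⟩ := exists_eq_comp_of_ker_le hBo hw ((sl 2).mono (hBU le_rfl)) hpB
    (by intro h0; have := (hw' p hpB).2.1; rw [h0] at this; simp at this)
    (by
      intro q hq v hv
      obtain ⟨c₀, c₁, c₂, hv'⟩ : ∃ c₀ c₁ c₂ : ℝ, v = c₀ • f q + c₁ • g q + c₂ • h q :=
        ⟨_, _, _, eq_coords_triple (by simp) ((regularOn_iff f g U).1 hcan.1 q (hBU le_rfl hq)).1 v⟩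
      obtain ⟨w1, w2, w3⟩ := hw' q hq
      rw [hv'] at hv ⊢
      simp only [map_add, map_smul, w1, w2, w3, smul_eq_mul] at hv
      have hc1 : c₁ = 0 := by linarith
      have e1 := hν q (hBU le_rfl hq)
      have e2 := hν' q (hBU le_rfl hq)
      change fderiv ℝ ν q _ = 0
      rw [map_add, map_add, map_smul, map_smul, map_smul, e1, e2, hc1]
      simp)
  -- The equation is the closedness condition on the pair g, h. The initial data (1, 0) and (0, 1)
  -- will send f, h, g at `p` to the standard basis.
  obtain ⟨r₁, hr₁, hr₁₀, F₁, F₁', sF₁, sF₁', ode₁, hF₁, hF₁'⟩ :=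
    exists_linear_ode_solution (ε := ε) hr₀ hN 1 0
  obtain ⟨r₂, hr₂, hr₂₁, F₂, F₂', sF₂, sF₂', ode₂, hF₂, hF₂'⟩ :=
    exists_linear_ode_solution (ε := ε) (t₀ := w p) hr₁ (hN.mono (Ioo_subset_Ioo (by linarith) (by linarith)))
      0 1
  set I := Ioo (w p - r₂) (w p + r₂) with hI
  have hIo : IsOpen I := isOpen_Ioo
  have hpI : w p ∈ I := ⟨by linarith, by linarith⟩
  have hI₁ : I ⊆ Ioo (w p - r₁) (w p + r₁) := Ioo_subset_Ioo (by linarith) (by linarith)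
  replace sF₁ := sF₁.mono hI₁
  replace sF₁' := sF₁'.mono hI₁
  replace ode₁ := fun t (ht : t ∈ I) => ode₁ t (hI₁ ht)
  have sN : ContDiffOn ℝ ∞ N I := hN.mono (Ioo_subset_Ioo (by linarith) (by linarith))
  have hwI : ∀ᶠ q in 𝓝 p, w q ∈ I :=
    (hw.continuousOn.continuousAt (hBo.mem_nhds hpB)).eventually (hIo.mem_nhds hpI)
  obtain ⟨r', hr', hball'⟩ := Metric.eventually_nhds_iff_ball.1 (hNw.and hwI)
  set r := min ρ r' with hr
  have hrρ : r ≤ ρ := min_le_left _ _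
  have hr0 : 0 < r := lt_min hρ hr'
  set B := Metric.ball p r with hB
  have hBopen : IsOpen B := Metric.isOpen_ball
  have hpB' : p ∈ B := Metric.mem_ball_self hr0
  have hBρ : B ⊆ Metric.ball p ρ := Metric.ball_subset_ball hrρ
  have hBr' : B ⊆ Metric.ball p r' := Metric.ball_subset_ball (min_le_right _ _)
  have hwB := hw.mono hBρ
  -- the primitives `x` and `y`
  have xy : ∀ F F' : ℝ → ℝ, ContDiffOn ℝ ∞ F I → ContDiffOn ℝ ∞ F' I →
      (∀ t ∈ I, HasDerivAt F (F' t) t ∧ HasDerivAt F' (ε * F t + N t * F' t) t) →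
      ∃ x : E3 → ℝ, ContDiffOn ℝ ∞ x B ∧ ∀ q ∈ B, fderiv ℝ x q (f q) = F (w q) ∧
        fderiv ℝ x q (g q) = 0 ∧ fderiv ℝ x q (h q) = F' (w q) := by
    intro F F' sF sF' ode
    refine prim r hrρ (fun q => F (w q)) (fun _ => 0) (fun q => F' (w q))
      (sF.comp hwB fun q hq => (hball' q (hBr' hq)).2) contDiffOn_const
      (sF'.comp hwB fun q hq => (hball' q (hBr' hq)).2) fun q hq => ?_
    obtain ⟨hνq, hwq⟩ := hball' q (hBr' hq)
    obtain ⟨w1, w2, w3⟩ := hw' q (hBρ hq)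
    have dw := (differentiableAt_of_mem hBo hw (hBρ hq)).hasFDerivAt
    have e₁ : fderiv ℝ (fun q => F (w q)) q = _ := ((ode _ hwq).1.comp_hasFDerivAt q dw).fderiv
    have e₂ : fderiv ℝ (fun q => F' (w q)) q = _ := ((ode _ hwq).2.comp_hasFDerivAt q dw).fderiv
    rw [e₁, e₂]
    simp [w1, w2, w3, ν, hνq]
  obtain ⟨x, sx, hx⟩ := xy F₁ F₁' sF₁ sF₁' ode₁
  obtain ⟨y, sy, hy⟩ := xy F₂ F₂' sF₂ sF₂' ode₂
  -- Translating x and y sends `p` to (0, 0, w p), the point around which `secToTriv` is inverted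
  -- below.
  set Φ : E3 → E3 := fun q => !₂[x q - x p, y q - y p, w q] with hΦ
  have sΦ : ContDiffOn ℝ ∞ Φ B :=
    contDiffOn_vec3 (sx.sub contDiffOn_const) (sy.sub contDiffOn_const) hwB
  have dΦ : ∀ q ∈ B, ∀ v, fderiv ℝ Φ q v = !₂[fderiv ℝ x q v, fderiv ℝ y q v, fderiv ℝ w q v] := by
    intro q hq v
    refine (fderiv_vec3 ((differentiableAt_of_mem hBopen sx hq).sub_const _)
      ((differentiableAt_of_mem hBopen sy hq).sub_const _)
      (differentiableAt_of_mem hBopen hwB hq) v).trans ?_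
    rw [fderiv_sub_const, fderiv_sub_const]
  have Φf : ∀ q ∈ B, fderiv ℝ Φ q (f q) = !₂[F₁ (w q), F₂ (w q), 0] := fun q hq => by
    rw [dΦ q hq, (hx q hq).1, (hy q hq).1, (hw' q (hBρ hq)).1]
  have Φg : ∀ q ∈ B, fderiv ℝ Φ q (g q) = !₂[0, 0, 1] := fun q hq => by
    rw [dΦ q hq, (hx q hq).2.1, (hy q hq).2.1, (hw' q (hBρ hq)).2.1]
  have Φh : ∀ q ∈ B, fderiv ℝ Φ q (h q) = !₂[F₁' (w q), F₂' (w q), 0] := fun q hq => by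
    rw [dΦ q hq, (hx q hq).2.2, (hy q hq).2.2, (hw' q (hBρ hq)).2.2]
  obtain ⟨φ, hpφ, hφB, hφ⟩ := exists_localDiffeo hBopen sΦ hpB'
    (isInvertible_of_linearIndependent (u := f p) (v := h p) (w := g p) (by
      rw [Φf p hpB', Φg p hpB', Φh p hpB', hF₁, hF₁', hF₂, hF₂']
      exact linearIndependent_std one_ne_zero))
  have hφ2 : ∀ q, φ q 2 = w q := fun q => by rw [hφ]; rfl
  have pf : PushesTo (M := E3) φ f (trivF F₁ F₂) :=
    pushesTo_of_fderiv hφ fun q hq => Φf q (hφB hq)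
  have pg : PushesTo (M := E3) φ g trivG := pushesTo_of_fderiv hφ fun q hq => Φg q (hφB hq)
  have hφU : φ.source ⊆ U := fun q hq => hBU le_rfl (hBρ (hφB hq))
  have hl0 : ∀ q ∈ φ.source, lamFun (M := E3) f g 0 q = ε := fun q hq =>
    (hball q (hBρ (hφB hq))).1
  have hφI : wRange φ ⊆ I := by
    rintro _ ⟨q, hq, rfl⟩
    have hq' := φ.map_target hq
    have h2 := hφ2 (φ.symm q)
    rw [show φ (φ.symm q) = q from φ.right_inv hq] at h2
    change q 2 ∈ I
    rw [h2]
    exact (hball' _ (hBr' (hφB hq'))).2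
  refine ⟨⟨φ, F₁, F₂, hpφ, hφU, sF₁.mono hφI, sF₂.mono hφI, pf, pg, hl0⟩, ?_⟩
  set Θ := secToTriv F₁ F₁' F₂ F₂' with hΘ
  set p' : E3 := !₂[0, 0, w p] with hp'
  have hIo' : IsOpen {q : E3 | q 2 ∈ I} := isOpen_coord_preimage hIo
  have dΘ : ∀ q : E3, q 2 ∈ I → ∀ v : E3, fderiv ℝ Θ q v = _ := fun q hq v =>
    fderiv_secToTriv (ode₁ _ hq).1 (ode₁ _ hq).2 (ode₂ _ hq).1 (ode₂ _ hq).2 v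
  have hp'I : p' ∈ {q : E3 | q 2 ∈ I} := hpI
  obtain ⟨ψ, hpψ, hψI, hψ⟩ := exists_localDiffeo hIo' (contDiffOn_secToTriv sF₁ sF₁' sF₂ sF₂') hp'I
    (isInvertible_of_linearIndependent (u := !₂[1, 0, 0]) (v := !₂[0, 1, 0]) (w := !₂[0, 0, 1]) (by
      have e : p' 2 = w p := rfl
      have k1 : fderiv ℝ Θ p' !₂[1, 0, 0] = !₂[1, 0, 0] := by
        rw [dΘ p' hp'I, e, hF₁, hF₁', hF₂, hF₂', vec3_eq_iff]
        simp
      have k2 : fderiv ℝ Θ p' !₂[0, 1, 0] = !₂[0, -1, 0] := by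
        rw [dΘ p' hp'I, e, hF₁, hF₁', hF₂, hF₂', vec3_eq_iff]
        simp
      have k3 : fderiv ℝ Θ p' !₂[0, 0, 1] = !₂[0, 0, 1] := by
        rw [dΘ p' hp'I, e, hF₁, hF₁', hF₂, hF₂', vec3_eq_iff]
        simp [p']
      rw [k1, k2, k3]
      exact linearIndependent_std (by norm_num)))
  -- The field ∂x goes to (F₁, F₂, 0), since `secToTriv` is affine in x.
  have qf : PushesTo (M := E3) ψ secF (trivF F₁ F₂) := pushesTo_of_fderiv hψ fun q hq => by
    refine (dΘ q (hψI hq) _).trans (vec3_eq_iff.2 ?_)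
    simp [secF, secToTriv]
  -- Along `secG`, x F - y F' has derivative ε y F + x F' - (x - N y) F' - y F'', which vanishes by
  -- F'' = ε F + N F'.
  have qg : PushesTo (M := E3) ψ (secG ε N) trivG := pushesTo_of_fderiv hψ fun q hq => by
    refine (dΘ q (hψI hq) _).trans (vec3_eq_iff.2 ?_)
    simp only [secG]
    refine ⟨?_, ?_, ?_⟩ <;> simp <;> ring
  have hΘp : ψ p' = φ p := by
    rw [hψ, hφ]
    refine vec3_eq_iff.2 ?_
    simp [p']
  have hψ2 : ∀ q ∈ ψ.target, ψ.invFun q 2 = q 2 := fun q hq => by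
    have h1 : ψ (ψ.invFun q) = q := ψ.right_inv hq
    conv_rhs => rw [← h1, hψ]
    rfl
  refine ⟨PartialDiffeomorph.trans φ (PartialDiffeomorph.symm ψ), N, ⟨hpφ, ?_⟩,
    fun q hq => hφU hq.1, sN.mono ?_, pf.trans qf.symm, pg.trans qg.symm,
    fun q hq => ⟨hl0 q hq.1, ?_⟩⟩
  · change φ p ∈ ψ.target
    rw [← hΘp]
    exact ψ.map_source hpψ
  · rintro _ ⟨q, hq, rfl⟩
    exact hψI hq.1
  · have h1 : φ q ∈ ψ.target := hq.2
    change ν q = N (ψ.invFun (φ q) 2)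
    rw [hψ2 _ h1, hφ2]
    exact (hball' _ (hBr' (hφB hq.1))).1

end NormalForms

/-! ### Locality: structure functions depend only on germs, and a canonical pair is its own
canonical pair. -/

section Locality

variable {U : Set E3} (hU : IsOpen U) {f g f' g' : E3 → E3}

include hU in
theorem lieBracket_eqOn (hf : EqOn f f' U) (hg : EqOn g g' U) :
    EqOn (lieBracket ℝ f g) (lieBracket ℝ f' g') U := fun _ hp =>
  EventuallyEq.lieBracket_vectorField_eq (eventually_of_mem (hU.mem_nhds hp) hf)
    (eventually_of_mem (hU.mem_nhds hp) hg)

include hU in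
theorem regularOn_congr (hf : EqOn f f' U) (hg : EqOn g g' U) (h : RegularOn (M := E3) f g U) :
    RegularOn (M := E3) f' g' U := by
  have hb := lieBracket_eqOn hU hg hf
  rw [regularOn_iff] at h ⊢
  intro p hp
  rw [← hf hp, ← hg hp, ← hb hp, ← lieBracket_eqOn hU hg hb hp]
  exact h p hp

include hU in
theorem kFun_congr (hf : EqOn f f' U) (hg : EqOn g g' U) {p : E3} (hp : p ∈ U) (i : Fin 3) :
    kFun (M := E3) f g i p = kFun (M := E3) f' g' i p := by
  have hb := lieBracket_eqOn hU hg hf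
  rw [kFun_eq, kFun_eq, hg hp, hb hp, lieBracket_eqOn hU hg hb hp, lieBracket_eqOn hU hf hb hp]

include hU in
theorem lamFun_congr (hf : EqOn f f' U) (hg : EqOn g g' U) {p : E3} (hp : p ∈ U) (i : Fin 3) :
    lamFun (M := E3) f g i p = lamFun (M := E3) f' g' i p := by
  have hb := lieBracket_eqOn hU hg hf
  rw [lamFun_eq, lamFun_eq, hf hp, hg hp, hb hp, lieBracket_eqOn hU hg hb hp]

include hU in
theorem isCanonicalOn_congr (hf : EqOn f f' U) (hg : EqOn g g' U)
    (h : IsCanonicalOn (M := E3) f g U) : IsCanonicalOn (M := E3) f' g' U :=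
  ⟨regularOn_congr hU hf hg h.1, fun p hp => by
    rw [← kFun_congr hU hf hg hp, ← lamFun_congr hU hf hg hp]
    exact h.2 p hp⟩

theorem IsCanonicalOn.eqOn_canF (h : IsCanonicalOn (M := E3) f g U) :
    EqOn (canF (M := E3) f g : E3 → E3) f U := fun p hp => by
  refine (congrArg (fun c : ℝ => f p + c • g p) (h.2 p hp).1).trans ?_
  simp

theorem IsCanonicalOn.eqOn_canG (h : IsCanonicalOn (M := E3) f g U) :
    EqOn (canG (M := E3) f g : E3 → E3) g U := fun p hp => by
  have h1 : |lamFun (M := E3) f g 0 p| = 1 := by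
    rcases (h.2 p hp).2 with h | h <;> simp [h]
  refine (congrArg (fun c : ℝ => (c ^ (-(1 / 2) : ℝ)) • g p) h1).trans ?_
  simp

include hU in
theorem IsCanonicalOn.invariants (h : IsCanonicalOn (M := E3) f g U) {p : E3} (hp : p ∈ U) :
    epsInv (M := E3) f g p = lamFun (M := E3) f g 0 p ∧
      kappaInv (M := E3) f g p = kFun (M := E3) f g 0 p ∧
      nuInv (M := E3) f g p = lamFun (M := E3) f g 2 p :=
  ⟨lamFun_congr hU h.eqOn_canF h.eqOn_canG hp 0, kFun_congr hU h.eqOn_canF h.eqOn_canG hp 0,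
    lamFun_congr hU h.eqOn_canF h.eqOn_canG hp 2⟩

end Locality

/-! ### Smoothness of the model systems on the image of an equivalence. -/

section WRange

variable {M : Type*} [TopologicalSpace M] [ChartedSpace E3 M] (φ : LocalDiffeo M)

theorem mem_wRange {p : E3} (hp : p ∈ φ.target) : p 2 ∈ wRange φ := ⟨p, hp, rfl⟩

theorem isOpen_wRange : IsOpen (wRange φ) := by
  have h : Function.Surjective (EuclideanSpace.proj 2 : E3 →L[ℝ] ℝ) := fun t =>
    ⟨!₂[0, 0, t], rfl⟩
  exact (EuclideanSpace.proj 2 : E3 →L[ℝ] ℝ).isOpenMap h _ φ.open_target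

theorem contDiffOn_trivF_target {F₁ F₂ : ℝ → ℝ} (h₁ : ContDiffOn ℝ ∞ F₁ (wRange φ))
    (h₂ : ContDiffOn ℝ ∞ F₂ (wRange φ)) :
    ContDiffOn ℝ ∞ (trivF F₁ F₂ : E3 → E3) φ.target :=
  (contDiffOn_trivF h₁ h₂).mono fun _ hp => mem_wRange φ hp

theorem contDiffOn_secG_target {N : ℝ → ℝ} (hN : ContDiffOn ℝ ∞ N (wRange φ)) (ε : ℝ) :
    ContDiffOn ℝ ∞ (secG ε N : E3 → E3) φ.target := by
  have d : ∀ i : Fin 3, ContDiffOn ℝ ∞ (fun q : E3 => q i) φ.target := fun i =>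
    (contDiff_coord i).contDiffOn
  have c : ContDiffOn ℝ ∞ (fun q : E3 => N (q 2)) φ.target :=
    hN.comp (d 2) fun _ hp => mem_wRange φ hp
  exact contDiffOn_vec3 (contDiffOn_const.mul (d 1)) ((d 0).sub (c.mul (d 1))) contDiffOn_const

end WRange

/-! ### Feedback equivalences and canonical pairs on the manifold. -/

section Manifold

variable {M : Type*} [TopologicalSpace M] [ChartedSpace E3 M]

theorem PushesTo.eqOn {φ : LocalDiffeo M} {f : VF M} {u v : VF E3} (hu : PushesTo φ f u)
    (hv : PushesTo φ f v) : EqOn (u : E3 → E3) (v : E3 → E3) φ.target := fun p hp => by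
  have h1 := (hu _ (φ.map_target hp)).symm.trans (hv _ (φ.map_target hp))
  rw [φ.toPartialEquiv.right_inv hp] at h1
  exact h1

theorem contMDiffOn_of_push {φ : LocalDiffeo M} {k : M → ℝ} {k' : E3 → ℝ}
    (hk' : ContDiffOn ℝ ∞ k' φ.target) (hk : ∀ ξ ∈ φ.source, k' (φ ξ) = k ξ) :
    ContMDiffOn (𝓡 3) 𝓘(ℝ, ℝ) ∞ k φ.source :=
  (hk'.contMDiffOn.comp φ.contMDiffOn_toFun fun _ hξ => φ.map_source hξ).congr
    fun ξ hξ => (hk ξ hξ).symm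

theorem contDiffOn_comp_invFun {φ : LocalDiffeo M} {k : M → ℝ}
    (hk : ContMDiffOn (𝓡 3) 𝓘(ℝ, ℝ) ∞ k φ.source) :
    ContDiffOn ℝ ∞ (k ∘ φ.invFun) φ.target :=
  contMDiffOn_iff_contDiffOn.1 (hk.comp φ.contMDiffOn_invFun fun _ hp => φ.map_target hp)

variable [IsManifold (𝓡 3) ∞ M] {f g : VF M} (hf : SmoothVF f) (hg : SmoothVF g)
  (hreg : RegularOn f g univ) (φ : LocalDiffeo M)

include hf hg hreg in
theorem regularOn_pushVF : RegularOn (pushVF φ f) (pushVF φ g) φ.target := by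
  have pf := pushesTo_pushVF φ f
  have pg := pushesTo_pushVF φ g
  exact (regularOn_push pf pg (contDiffOn_push pf hf) (contDiffOn_push pg hg)).2
    fun ξ _ => hreg ξ trivial

variable {φ} {u v : VF E3}

include hf hg hreg in
-- The system and its feedback are carried to the target; there `feedback_structure` preserves
-- regularity, and the transformed pair agrees with `u`, `v`.
theorem FeedbackEquivVia.regularOn (h : FeedbackEquivVia φ f g u v) : RegularOn u v φ.target := by
  obtain ⟨α, β, hα, hβ, hβ0, pu, pv⟩ := h
  have pf := pushesTo_pushVF φ f
  have pg := pushesTo_pushVF φ g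
  have hi : ∀ ξ ∈ φ.source, φ.invFun (φ ξ) = ξ := fun ξ hξ => φ.left_inv hξ
  have hr := (feedback_structure φ.open_target (contDiffOn_push pf hf) (contDiffOn_push pg hg)
    (contDiffOn_comp_invFun hα) (contDiffOn_comp_invFun hβ)
    (fun p hp => hβ0 _ (φ.map_target hp)) (regularOn_pushVF hf hg hreg φ)).1
  refine regularOn_congr φ.open_target (PushesTo.eqOn (φ := φ) ?_ pu)
    (PushesTo.eqOn (φ := φ) ?_ pv) hr
  · intro ξ hξ
    simp only [Function.comp_apply]
    rw [map_add, map_smul, pf ξ hξ, pg ξ hξ, hi ξ hξ]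
    rfl
  · intro ξ hξ
    simp only [Function.comp_apply]
    rw [map_smul, pg ξ hξ, hi ξ hξ]
    rfl

variable (pu : PushesTo φ (canF f g) u) (pv : PushesTo φ (canG f g) v)

include hf hg hreg pu pv in
-- The canonical pair is itself a feedback transform, with α = k₃ and β = |λ₁|^(-1/2). Smoothness of
-- both is checked on the target and pulled back.
theorem feedbackEquivVia_of_canonical : FeedbackEquivVia φ f g u v := by
  have pf := pushesTo_pushVF φ f
  have pg := pushesTo_pushVF φ g
  have sf := contDiffOn_push pf hf
  have sg := contDiffOn_push pg hg
  have hr := regularOn_pushVF hf hg hreg φ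
  have hl : ∀ p ∈ φ.target, lamFun (pushVF φ f) (pushVF φ g) 0 p ≠ 0 := fun p hp =>
    lamFun_zero_ne_zero hr hp
  refine ⟨kFun f g 2, fun ξ => |lamFun f g 0 ξ| ^ (-(1 / 2) : ℝ),
    contMDiffOn_of_push (contDiffOn_kFun φ.open_target sf sg hr 2)
      fun ξ hξ => kFun_push pf pg sf sg hξ 2, ?_, ?_, pu, pv⟩
  · exact contMDiffOn_of_push (contDiffOn_abs_rpow_lamFun φ.open_target sf sg hr)
      fun ξ hξ => by rw [lamFun_push pf pg sf sg hξ]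
  · intro ξ hξ
    have := hl _ (φ.map_source hξ)
    rw [show φ.toPartialEquiv ξ = φ ξ from rfl, lamFun_push pf pg sf sg hξ] at this
    exact (Real.rpow_pos_of_pos (abs_pos.2 this) _).ne'

include hf hg hreg pu pv in
theorem isCanonicalOn_of_push : IsCanonicalOn u v φ.target := by
  have pf := pushesTo_pushVF φ f
  have pg := pushesTo_pushVF φ g
  have sf := contDiffOn_push pf hf
  have sg := contDiffOn_push pg hg
  exact isCanonicalOn_congr φ.open_target ((canF_push pf pg sf sg).eqOn pu)
    ((canG_push pf pg sf sg).eqOn pv)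
    (isCanonicalOn_can φ.open_target sf sg (regularOn_pushVF hf hg hreg φ))

end Manifold

/-! ### Transfer of the canonical forms from a chart to the manifold. -/

section Existence

variable {M : Type*} [TopologicalSpace M] [ChartedSpace E3 M] [IsManifold (𝓡 3) ∞ M] {f g : VF M}

omit [IsManifold (𝓡 3) ∞ M] in
theorem wRange_trans_subset (φ : LocalDiffeo M) (ψ : LocalDiffeo E3) :
    wRange (PartialDiffeomorph.trans φ ψ) ⊆ wRange ψ := by
  rintro _ ⟨q, hq, rfl⟩
  exact ⟨q, hq.1, rfl⟩

/-- A system satisfying the triviality conditions has both canonical forms around each point. -/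
theorem exists_canonical_forms (hf : SmoothVF f) (hg : SmoothVF g) (hreg : RegularOn f g univ)
    (htriv : TrivialityConditions f g) (ξ₀ : M) :
    ∃ ε : ℝ, (ε = 1 ∨ ε = -1) ∧
      (∃ (φ : LocalDiffeo M) (F₁ F₂ : ℝ → ℝ), ξ₀ ∈ φ.source ∧
        ContDiffOn ℝ ∞ F₁ (wRange φ) ∧ ContDiffOn ℝ ∞ F₂ (wRange φ) ∧
        PushesTo φ (canF f g) (trivF F₁ F₂) ∧ PushesTo φ (canG f g) trivG ∧
        ∀ ξ ∈ φ.source, epsInv f g ξ = ε) ∧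
      ∃ (φ : LocalDiffeo M) (N : ℝ → ℝ), ξ₀ ∈ φ.source ∧
        ContDiffOn ℝ ∞ N (wRange φ) ∧
        PushesTo φ (canF f g) secF ∧ PushesTo φ (canG f g) (secG ε N) ∧
        ∀ ξ ∈ φ.source, epsInv f g ξ = ε ∧ nuInv f g ξ = N (φ ξ 2) := by
  set χ : LocalDiffeo M := chartDiffeo ξ₀
  have hξ₀ : ξ₀ ∈ χ.source := mem_chart_source E3 ξ₀
  have hU := χ.open_target
  have pf := pushesTo_pushVF χ f
  have pg := pushesTo_pushVF χ g
  have sf := contDiffOn_push pf hf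
  have sg := contDiffOn_push pg hg
  have hr := regularOn_pushVF hf hg hreg χ
  set u : VF E3 := canF (pushVF χ f) (pushVF χ g)
  set v : VF E3 := canG (pushVF χ f) (pushVF χ g)
  have pu : PushesTo χ (canF f g) u := canF_push pf pg sf sg
  have pv : PushesTo χ (canG f g) v := canG_push pf pg sf sg
  have su : ContDiffOn ℝ ∞ (u : E3 → E3) χ.target := contDiffOn_canF hU sf sg hr
  have sv : ContDiffOn ℝ ∞ (v : E3 → E3) χ.target := contDiffOn_canG hU sf sg hr
  have hcan : IsCanonicalOn u v χ.target := isCanonicalOn_can hU sf sg hr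
  have hl : ∀ ξ ∈ χ.source, ∀ i, lamFun u v i (χ ξ) = lamFun (canF f g) (canG f g) i ξ :=
    fun ξ hξ i => lamFun_push pu pv su sv hξ i
  have hd : DifferentiableOn ℝ (lamFun u v 2) χ.target :=
    (contDiffOn_lamFun hU su sv hcan.1 2).differentiableOn (by simp)
  have push : ∀ P : E3 → Prop, (∀ ξ ∈ χ.source, P (χ ξ)) → ∀ p ∈ χ.target, P p :=
    fun P h p hp => by
      have := h _ (χ.map_target hp)
      rwa [χ.toPartialEquiv.right_inv hp] at this
  obtain ⟨ε, hε, ⟨ψ, F₁, F₂, h₁⟩, ψ', N, h₂⟩ := exists_normal_forms hU su sv hcan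
    (push _ fun ξ hξ => (kFun_push pu pv su sv hξ 0).trans (htriv ξ).1)
    (push _ fun ξ hξ => (lieD_push pu (fun η hη => hl η hη 2) hd hξ).trans (htriv ξ).2.1)
    (push _ fun ξ hξ => by
      have h := (lieD_push (pu.br pv su sv) (fun η hη => hl η hη 2) hd hξ).trans (htriv ξ).2.2
      rw [br_eq_lieBracket] at h
      -- The hypothesis concerns [f_c, g_c], whereas the frame uses [g_c, f_c].
      have e : lieBracket ℝ (v : E3 → E3) (u : E3 → E3) (χ ξ) =
        -lieBracket ℝ (u : E3 → E3) (v : E3 → E3) (χ ξ) := lieBracket_swap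
      rw [e, map_neg, neg_eq_zero]
      exact h)
    (χ.map_source hξ₀)
  refine ⟨ε, hε, ⟨PartialDiffeomorph.trans χ ψ, F₁, F₂, ⟨hξ₀, h₁.1⟩,
    h₁.2.2.1.mono (wRange_trans_subset χ ψ), h₁.2.2.2.1.mono (wRange_trans_subset χ ψ),
    pu.trans h₁.2.2.2.2.1, pv.trans h₁.2.2.2.2.2.1, fun ξ hξ => ?_⟩,
    PartialDiffeomorph.trans χ ψ', N, ⟨hξ₀, h₂.1⟩, h₂.2.2.1.mono (wRange_trans_subset χ ψ'),
    pu.trans h₂.2.2.2.1, pv.trans h₂.2.2.2.2.1, fun ξ hξ => ?_⟩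
  · exact (hl ξ hξ.1 0).symm.trans (h₁.2.2.2.2.2.2 _ hξ.2)
  · exact ⟨(hl ξ hξ.1 0).symm.trans (h₂.2.2.2.2.2 _ hξ.2).1,
      (hl ξ hξ.1 2).symm.trans (h₂.2.2.2.2.2 _ hξ.2).2⟩

end Existence

end TrivialControl

/-! ### The theorem, assembled from the canonical forms. -/

theorem mainTheorem8 {M : Type*} [TopologicalSpace M] [ChartedSpace E3 M]
    [IsManifold (𝓡 3) ∞ M] (f g : VF M)
    (hf : SmoothVF f) (hg : SmoothVF g)
    (hreg : RegularOn f g Set.univ)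
    (htriv : TrivialityConditions f g) (ξ₀ : M) :
    -- (i) the system admits the normal form (T) around `ξ₀`
    (∃ (φ : LocalDiffeo M) (F₁ F₂ : ℝ → ℝ), ξ₀ ∈ φ.source ∧
      ContDiffOn ℝ ∞ F₁ (wRange φ) ∧
      ContDiffOn ℝ ∞ F₂ (wRange φ) ∧
      FeedbackEquivVia φ f g (trivF F₁ F₂) trivG) ∧
    -- and each normal form (T) of the system has the stated structure functions
    (∀ (φ : LocalDiffeo M) (F₁ F₂ : ℝ → ℝ),
      ContDiffOn ℝ ∞ F₁ (wRange φ) →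
      ContDiffOn ℝ ∞ F₂ (wRange φ) →
      FeedbackEquivVia φ f g (trivF F₁ F₂) trivG →
      RegularOn (trivF F₁ F₂) trivG φ.target ∧
      ∀ p ∈ φ.target,
        wronsk F₁ F₂ (p 2) ≠ 0 ∧
        (∀ i, kFun (trivF F₁ F₂) trivG i p = 0) ∧
        lamFun (trivF F₁ F₂) trivG 0 p =
          -(wronsk (deriv F₁) (deriv F₂) (p 2) /
            wronsk F₁ F₂ (p 2)) ∧
        lamFun (trivF F₁ F₂) trivG 1 p = 0 ∧
        lamFun (trivF F₁ F₂) trivG 2 p =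
          deriv (wronsk F₁ F₂) (p 2) / wronsk F₁ F₂ (p 2)) ∧
    -- (ii) first canonical form
    (∃ (φ : LocalDiffeo M) (F₁ F₂ : ℝ → ℝ) (ε : ℝ), ξ₀ ∈ φ.source ∧
      (ε = 1 ∨ ε = -1) ∧
      ContDiffOn ℝ ∞ F₁ (wRange φ) ∧
      ContDiffOn ℝ ∞ F₂ (wRange φ) ∧
      FeedbackEquivVia φ f g (trivF F₁ F₂) trivG ∧
      PushesTo φ (canF f g) (trivF F₁ F₂) ∧
      PushesTo φ (canG f g) trivG ∧
      IsCanonicalOn (trivF F₁ F₂) trivG φ.target ∧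
      (∀ p ∈ φ.target,
        wronsk F₁ F₂ (p 2) ≠ 0 ∧
        wronsk (deriv F₁) (deriv F₂) (p 2) /
          wronsk F₁ F₂ (p 2) = -ε ∧
        epsInv (trivF F₁ F₂) trivG p =
          -(wronsk (deriv F₁) (deriv F₂) (p 2) /
            wronsk F₁ F₂ (p 2)) ∧
        kappaInv (trivF F₁ F₂) trivG p = 0 ∧
        nuInv (trivF F₁ F₂) trivG p =
          deriv (wronsk F₁ F₂) (p 2) / wronsk F₁ F₂ (p 2)) ∧
      (∀ ξ ∈ φ.source,
        epsInv f g ξ = ε ∧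
        nuInv f g ξ =
          deriv (wronsk F₁ F₂) (φ ξ 2) / wronsk F₁ F₂ (φ ξ 2))) ∧
    -- (ii) second canonical form
    (∃ (φ : LocalDiffeo M) (ε : ℝ) (ν : ℝ → ℝ), ξ₀ ∈ φ.source ∧
      (ε = 1 ∨ ε = -1) ∧
      ContDiffOn ℝ ∞ ν (wRange φ) ∧
      FeedbackEquivVia φ f g secF (secG ε ν) ∧
      PushesTo φ (canF f g) secF ∧
      PushesTo φ (canG f g) (secG ε ν) ∧
      IsCanonicalOn secF (secG ε ν) φ.target ∧
      (∀ p ∈ φ.target,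
        epsInv secF (secG ε ν) p = ε ∧
        kappaInv secF (secG ε ν) p = 0 ∧
        nuInv secF (secG ε ν) p = ν (p 2)) ∧
      (∀ ξ ∈ φ.source,
        epsInv f g ξ = ε ∧ nuInv f g ξ = ν (φ ξ 2))) := by
  have trivial_form : ∀ (φ : LocalDiffeo M) (F₁ F₂ : ℝ → ℝ), ContDiffOn ℝ ∞ F₁ (wRange φ) →
      ContDiffOn ℝ ∞ F₂ (wRange φ) → RegularOn (trivF F₁ F₂) trivG φ.target → _ :=
    fun φ F₁ F₂ h₁ h₂ h =>
      trivial_structure (isOpen_wRange φ) h₁ h₂ (fun _ hp => mem_wRange φ hp) h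
  obtain ⟨ε, hε, ⟨φ, F₁, F₂, hφ, h₁, h₂, pu, pv, hl⟩, ψ, N, hψ, hN, qu, qv, hl'⟩ :=
    exists_canonical_forms hf hg hreg htriv ξ₀
  have fe := feedbackEquivVia_of_canonical hf hg hreg pu pv
  have hc := isCanonicalOn_of_push hf hg hreg pu pv
  have hc' := isCanonicalOn_of_push hf hg hreg qu qv
  have str := trivial_form φ F₁ F₂ h₁ h₂ hc.1
  have su := contDiffOn_trivF_target φ h₁ h₂
  have sv := contDiff_trivG.contDiffOn (s := φ.target)
  have tu : ContDiffOn ℝ ∞ (secF : E3 → E3) ψ.target := contDiffOn_const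
  have tv := contDiffOn_secG_target ψ hN ε
  -- By naturality, λ₁ of the model equals ε; compared with the Wronskian formula for λ₁, this makes
  -- the quotient W(F₁',F₂')/W(F₁,F₂) the constant -ε.
  have key : ∀ p ∈ φ.target, lamFun (trivF F₁ F₂) trivG 0 p = ε := fun p hp => by
    have h := lamFun_push pu pv su sv (φ.map_target hp) 0
    rw [φ.toPartialEquiv.right_inv hp] at h
    exact h.trans (hl _ (φ.map_target hp))
  refine ⟨⟨φ, F₁, F₂, hφ, h₁, h₂, fe⟩, fun φ F₁ F₂ h₁ h₂ h => ?_,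
    ⟨φ, F₁, F₂, ε, hφ, hε, h₁, h₂, fe, pu, pv, hc, fun p hp => ?_, fun ξ hξ => ?_⟩,
    ⟨ψ, ε, N, hψ, hε, hN, feedbackEquivVia_of_canonical hf hg hreg qu qv, qu, qv, hc',
      fun p hp => ?_, hl'⟩⟩
  · have hr := h.regularOn hf hg hreg
    exact ⟨hr, trivial_form φ F₁ F₂ h₁ h₂ hr⟩
  · obtain ⟨s1, s2, s3, -, s5⟩ := str p hp
    obtain ⟨i1, i2, i3⟩ := hc.invariants φ.open_target hp
    refine ⟨s1, ?_, i1.trans s3, i2.trans (s2 0), i3.trans s5⟩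
    rw [← key p hp, s3, neg_neg]
  · exact ⟨hl ξ hξ, (lamFun_push pu pv su sv hξ 2).symm.trans
      (str _ (φ.map_source hξ)).2.2.2.2⟩
  · obtain ⟨i1, i2, i3⟩ := hc'.invariants ψ.open_target hp
    have hm := ψ.map_target hp
    have l := fun i => lamFun_push qu qv tu tv hm i
    have k := kFun_push qu qv tu tv hm 0
    have n := hl' _ hm
    rw [ψ.toPartialEquiv.right_inv hp] at k n
    rw [ψ.toPartialEquiv.right_inv hp] at l
    exact ⟨i1.trans ((l 0).trans n.1), i2.trans (k.trans (htriv _).1),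
      i3.trans ((l 2).trans n.2)⟩
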